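/- Let $\mathbb F=\mathbb R$ or $\mathbb C$ and let $\mathfrak g$ be a finite-dimensional simple Lie algebra over $\mathbb F$, with negative definite Killing form (i.e. compact) if $\mathbb F=\mathbb R$. For $\sigma\in\mathrm{Aut}(\mathfrak g)$ let $L(\mathfrak g,\sigma)=\{u\in C^\infty(\mathbb R,\mathfrak g): u(t+2\pi)=\sigma u(t)\}$ with the pointwise bracket $[\cdot,\cdot]_0$ and the form $(u,v)=\int_0^{2\pi}(u(t),v(t))_0\,dt$, where $(\cdot,\cdot)_0$ is the Killing form, and let $\hat L(\mathfrak g,\sigma)=L(\mathfrak g,\sigma)\oplus\mathbb Fc\oplus\mathbb Fd$ be the affine Kac–Moody algebra with $[u,v]=[u,v]_0+(u',v)c$, $[d,u]=u'$, $[c,x]=0$. Identify $L(\mathfrak g,\sigma)$ with the quotient of the derived algebra $L(\mathfrak g,\sigma)+\mathbb Fc$ by the centre $\mathbb Fc$. Say that a Lie algebra isomorphism $\hat\varphi:\hat L(\mathfrak g,\sigma)\to\hat L(\mathfrak g,\tilde\sigma)$ induces (or extends) the Lie algebra isomorphism $\varphi:L(\mathfrak g,\sigma)\to L(\mathfrak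 g,\tilde\sigma)$ if $\varphi$ is the map induced by $\hat\varphi$ on these quotients. Call $\varphi$ standard with data $(\varphi_t,\lambda,\epsilon)$ if $\varphi u(t)=\varphi_t(u(\lambda(t)))$ for all $u$ and $t$, where $\epsilon\in\{\pm1\}$, $t\mapsto\varphi_t\in\mathrm{Aut}(\mathfrak g)$ is smooth, $\lambda:\mathbb R\to\mathbb R$ is a diffeomorphism, $\lambda(t+2\pi)=\lambda(t)+2\pi\epsilon$ and $\varphi_{t+2\pi}=\tilde\sigma\varphi_t\sigma^{-\epsilon}$. **Theorem.** Let $\sigma,\tilde\sigma\in\mathrm{Aut}(\mathfrak g)$. (i) Every isomorphism $\hat\varphi:\hat L(\mathfrak g,\sigma)\to\hat L(\mathfrak g,\tilde\sigma)$ induces exactly one isomorphism $\varphi:L(\mathfrak g,\sigma)\to L(\mathfrak g,\tilde\sigma)$. If $\varphi$ is induced from $\hat\varphi$, then $\varphi$ is standard with data $(\varphi_t,\ t\mapsto\epsilon t+t_0,\ \epsilon)$ for some smooth curve $\varphi_t$, some $\epsilon\in\{\pm1\}$ and some $t_0\in\mathbb R$; in particular $\varphi u(t)=\varphi_t(u(\epsilon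 t+t_0))$. Moreover, whenever $\varphi$ is standard with data $(\varphi_t,\lambda,\epsilon)$, there is $t_0\in\mathbb R$ with $\lambda(t)=\epsilon t+t_0$ for all $t$. (ii) Conversely, let $\varphi:L(\mathfrak g,\sigma)\to L(\mathfrak g,\tilde\sigma)$ be an isomorphism with $\varphi u(t)=\varphi_t(u(\epsilon t+t_0))$ for all $u,t$, where $t\mapsto\varphi_t\in\mathrm{Aut}(\mathfrak g)$ is smooth, $\epsilon\in\{\pm1\}$ and $t_0\in\mathbb R$. Then $\varphi$ is induced by some isomorphism $\hat\varphi:\hat L(\mathfrak g,\sigma)\to\hat L(\mathfrak g,\tilde\sigma)$. There is exactly one $u_\varphi\in L(\mathfrak g,\tilde\sigma)$ with $\mathrm{ad}\,u_\varphi(t)=-\epsilon\,\varphi_t'\varphi_t^{-1}$ for all $t$. An isomorphism $\hat\varphi$ induces $\varphi$ if and only if, for this $u_\varphi$ and some $\nu_\varphi\in\mathbb F$, $$\hat\varphi c=\epsilon c,\qquad \hat\varphi d=\epsilon d+u_\varphi+\nu_\varphi c,\qquad \hat\varphi u=\varphi u-\epsilon(\varphi u,u_\varphi)\,c\quad\text{for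 all }u\in L(\mathfrak g,\sigma).$$ The constant $\nu_\varphi$ is arbitrary: for each $\nu\in\mathbb F$ there is exactly one isomorphism $\hat\varphi$ inducing $\varphi$ for which the $c$-coefficient of $\hat\varphi d$ is $\nu$. -/

import Mathlib

open scoped ContDiff

noncomputable section

namespace KacMoody

variable {𝕜 : Type*} [RCLike 𝕜] {g : Type*} [LieRing g] [LieAlgebra 𝕜 g]

/-- A map `u : ℝ → g` into a finite-dimensional vector space over `𝕜 = ℝ` or `ℂ` is smooth if all
its scalar components `ℓ ∘ u`, for `ℓ` in the dual space, are `C^∞` functions of the real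
variable. -/
def SmoothCurve (𝕜 : Type*) [RCLike 𝕜] {g : Type*} [LieRing g] [LieAlgebra 𝕜 g]
    (u : ℝ → g) : Prop :=
  ∀ l : Module.Dual 𝕜 g, ContDiff ℝ ∞ (fun t => l (u t))

/-- The derivative of a curve in a finite-dimensional space, taken componentwise in a basis.
See `apply_curveDeriv`: it is the vector with `ℓ (u' t) = (ℓ ∘ u)' t` for all `ℓ`. -/
def curveDeriv (𝕜 : Type*) [RCLike 𝕜] {g : Type*} [LieRing g] [LieAlgebra 𝕜 g]
    [FiniteDimensional 𝕜 g] (u : ℝ → g) (t : ℝ) : g :=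
  ∑ i, deriv (fun s => (Module.finBasis 𝕜 g).repr (u s) i) t • Module.finBasis 𝕜 g i

section Curves

variable [FiniteDimensional 𝕜 g]

theorem dual_apply_eq_sum (l : Module.Dual 𝕜 g) (x : g) :
    l x = ∑ i, (Module.finBasis 𝕜 g).repr x i * l (Module.finBasis 𝕜 g i) := by
  have h := congrArg l ((Module.finBasis 𝕜 g).sum_repr x)
  simp only [map_sum, map_smul, smul_eq_mul] at h
  exact h.symm

theorem smoothCurve_iff_repr {u : ℝ → g} :
    SmoothCurve 𝕜 u ↔ ∀ i, ContDiff ℝ ∞ (fun t => (Module.finBasis 𝕜 g).repr (u t) i) := by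
  constructor
  · intro h i
    exact h ((Module.finBasis 𝕜 g).coord i)
  · intro h l
    rw [show (fun t => l (u t)) = _ from funext fun t => dual_apply_eq_sum l (u t)]
    exact ContDiff.sum fun i _ => (h i).mul contDiff_const

theorem apply_curveDeriv {u : ℝ → g} (hu : SmoothCurve 𝕜 u) (l : Module.Dual 𝕜 g) (t : ℝ) :
    l (curveDeriv 𝕜 u t) = deriv (fun s => l (u s)) t := by
  have hd : ∀ i, DifferentiableAt ℝ (fun s => (Module.finBasis 𝕜 g).repr (u s) i) t :=
    fun i => ((smoothCurve_iff_repr.1 hu i).differentiable (by simp)).differentiableAt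
  rw [show (fun s => l (u s)) = _ from funext fun s => dual_apply_eq_sum l (u s)]
  rw [deriv_fun_sum (fun i _ => (hd i).mul_const _)]
  simp [curveDeriv, map_sum, deriv_mul_const (hd _)]

theorem hasDerivAt_dual {u : ℝ → g} (hu : SmoothCurve 𝕜 u) (l : Module.Dual 𝕜 g) (t : ℝ) :
    HasDerivAt (fun s => l (u s)) (l (curveDeriv 𝕜 u t)) t := by
  rw [apply_curveDeriv hu]
  exact (((hu l).differentiable (by simp)).differentiableAt).hasDerivAt

theorem dual_ext {x y : g} (h : ∀ l : Module.Dual 𝕜 g, l x = l y) : x = y :=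
  (Module.finBasis 𝕜 g).ext_elem fun i => h ((Module.finBasis 𝕜 g).coord i)

theorem SmoothCurve.curveDeriv {u : ℝ → g} (hu : SmoothCurve 𝕜 u) :
    SmoothCurve 𝕜 (curveDeriv 𝕜 u) := by
  intro l
  have : (fun t => l (KacMoody.curveDeriv 𝕜 u t)) = deriv (fun s => l (u s)) :=
    funext fun t => apply_curveDeriv hu l t
  rw [this]
  exact ((contDiff_infty_iff_deriv (𝕜 := ℝ)).1 (hu l)).2

theorem bilin_eq_sum (B : g →ₗ[𝕜] g →ₗ[𝕜] 𝕜) (x y : g) :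
    B x y = ∑ i, ∑ j, (Module.finBasis 𝕜 g).repr x i * ((Module.finBasis 𝕜 g).repr y j *
      B (Module.finBasis 𝕜 g i) (Module.finBasis 𝕜 g j)) := by
  have h1 := dual_apply_eq_sum (B.flip y) x
  simp only [LinearMap.flip_apply] at h1
  rw [h1]
  refine Finset.sum_congr rfl fun i _ => ?_
  rw [dual_apply_eq_sum (B (Module.finBasis 𝕜 g i)) y, Finset.mul_sum]

theorem contDiff_bilin (B : g →ₗ[𝕜] g →ₗ[𝕜] 𝕜) {u v : ℝ → g} (hu : SmoothCurve 𝕜 u)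
    (hv : SmoothCurve 𝕜 v) : ContDiff ℝ ∞ (fun t => B (u t) (v t)) := by
  rw [show (fun t => B (u t) (v t)) = _ from funext fun t => bilin_eq_sum B (u t) (v t)]
  rw [smoothCurve_iff_repr] at hu hv
  exact ContDiff.sum fun i _ => ContDiff.sum fun j _ =>
    (hu i).mul ((hv j).mul contDiff_const)

theorem hasDerivAt_bilin (B : g →ₗ[𝕜] g →ₗ[𝕜] 𝕜) {u v : ℝ → g} (hu : SmoothCurve 𝕜 u)
    (hv : SmoothCurve 𝕜 v) (t : ℝ) :
    HasDerivAt (fun t => B (u t) (v t))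
      (B (curveDeriv 𝕜 u t) (v t) + B (u t) (curveDeriv 𝕜 v t)) t := by
  rw [show (fun t => B (u t) (v t)) = _ from funext fun t => bilin_eq_sum B (u t) (v t),
    bilin_eq_sum B (curveDeriv 𝕜 u t), bilin_eq_sum B (u t)]
  have hu' := fun i => hasDerivAt_dual hu ((Module.finBasis 𝕜 g).coord i) t
  have hv' := fun i => hasDerivAt_dual hv ((Module.finBasis 𝕜 g).coord i) t
  simp only [Module.Basis.coord_apply] at hu' hv'
  have := HasDerivAt.fun_sum (u := Finset.univ) fun i _ =>
    HasDerivAt.fun_sum (u := Finset.univ) fun j _ =>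
      (hu' i).mul ((hv' j).mul_const (B (Module.finBasis 𝕜 g i) (Module.finBasis 𝕜 g j)))
  refine this.congr_deriv ?_
  simp only [Finset.sum_add_distrib]

theorem SmoothCurve.lie {u v : ℝ → g} (hu : SmoothCurve 𝕜 u) (hv : SmoothCurve 𝕜 v) :
    SmoothCurve 𝕜 (fun t => ⁅u t, v t⁆) := fun l =>
  contDiff_bilin ((LieModule.toEnd 𝕜 g g : g →ₗ[𝕜] Module.End 𝕜 g).compr₂ l) hu hv

theorem curveDeriv_lie {u v : ℝ → g} (hu : SmoothCurve 𝕜 u) (hv : SmoothCurve 𝕜 v) (t : ℝ) :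
    curveDeriv 𝕜 (fun t => ⁅u t, v t⁆) t =
      ⁅curveDeriv 𝕜 u t, v t⁆ + ⁅u t, curveDeriv 𝕜 v t⁆ := by
  refine dual_ext (𝕜 := 𝕜) fun l => ?_
  rw [apply_curveDeriv (hu.lie hv), map_add]
  exact (hasDerivAt_bilin
    ((LieModule.toEnd 𝕜 g g : g →ₗ[𝕜] Module.End 𝕜 g).compr₂ l) hu hv t).deriv

theorem curveDeriv_add {u v : ℝ → g} (hu : SmoothCurve 𝕜 u) (hv : SmoothCurve 𝕜 v) (t : ℝ) :
    curveDeriv 𝕜 (u + v) t = curveDeriv 𝕜 u t + curveDeriv 𝕜 v t := by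
  refine dual_ext (𝕜 := 𝕜) fun l => ?_
  have huv : SmoothCurve 𝕜 (u + v) := fun l => by simpa using (hu l).add (hv l)
  rw [apply_curveDeriv huv, map_add]
  simpa using ((hasDerivAt_dual hu l t).fun_add (hasDerivAt_dual hv l t)).deriv

theorem curveDeriv_smul (a : 𝕜) {u : ℝ → g} (hu : SmoothCurve 𝕜 u) (t : ℝ) :
    curveDeriv 𝕜 (a • u) t = a • curveDeriv 𝕜 u t := by
  refine dual_ext (𝕜 := 𝕜) fun l => ?_
  have hau : SmoothCurve 𝕜 (a • u) := fun l => by simpa using contDiff_const.mul (hu l)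
  rw [apply_curveDeriv hau, map_smul]
  simpa using ((hasDerivAt_dual hu l t).const_mul a).deriv

end Curves

/-- The smooth `u : ℝ → g` with `u (t + 2π) = σ (u t)`, as a space of functions. -/
def loopSubmodule (σ : g ≃ₗ⁅𝕜⁆ g) : Submodule 𝕜 (ℝ → g) where
  carrier := {u | SmoothCurve 𝕜 u ∧ ∀ t, u (t + 2 * Real.pi) = σ (u t)}
  add_mem' := fun {u v} hu hv =>
    ⟨fun l => by simpa using (hu.1 l).add (hv.1 l), fun t => by simp [hu.2 t, hv.2 t]⟩
  zero_mem' := ⟨fun l => by simpa using contDiff_const, fun t => by simp⟩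
  smul_mem' := fun a u hu =>
    ⟨fun l => by simpa using contDiff_const.mul (hu.1 l), fun t => by simp [hu.2 t]⟩

/-- The twisted loop algebra `L(g, σ)`. -/
abbrev Loop (σ : g ≃ₗ⁅𝕜⁆ g) : Type _ := loopSubmodule σ

section LoopAlgebra

variable [FiniteDimensional 𝕜 g] {σ : g ≃ₗ⁅𝕜⁆ g}

/-- The pointwise bracket `[u, v]₀ (t) = [u t, v t]`. -/
instance : Bracket (Loop σ) (Loop σ) where
  bracket u v := ⟨fun t => ⁅u.1 t, v.1 t⁆, u.2.1.lie v.2.1, fun t => by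
    change ⁅u.1 (t + _), v.1 (t + _)⁆ = σ ⁅u.1 t, v.1 t⁆
    rw [u.2.2, v.2.2, LieEquiv.map_lie]⟩

theorem Loop.lie_apply (u v : Loop σ) (t : ℝ) : (⁅u, v⁆ : Loop σ).1 t = ⁅u.1 t, v.1 t⁆ := rfl

instance : LieRing (Loop σ) where
  add_lie u v w := Subtype.ext <| funext fun t => by simp [Loop.lie_apply]
  lie_add u v w := Subtype.ext <| funext fun t => by simp [Loop.lie_apply]
  lie_self u := Subtype.ext <| funext fun t => by simp [Loop.lie_apply]
  leibniz_lie u v w := Subtype.ext <| funext fun t => by simp [Loop.lie_apply]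

instance : LieAlgebra 𝕜 (Loop σ) where
  lie_smul a u v := Subtype.ext <| funext fun t => by simp [Loop.lie_apply]

/-- The derivative `u'` of a loop `u`. -/
def Loop.deriv (u : Loop σ) : Loop σ :=
  ⟨curveDeriv 𝕜 u.1, u.2.1.curveDeriv, fun t => by
    refine dual_ext (𝕜 := 𝕜) fun l => ?_
    have h := apply_curveDeriv u.2.1 (l ∘ₗ (σ : g →ₗ[𝕜] g)) t
    simp only [LinearMap.comp_apply] at h
    rw [apply_curveDeriv u.2.1, ← deriv_comp_add_const]
    simp only [u.2.2]
    exact h.symm⟩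

/-- The bilinear form `(u, v) = ∫₀^{2π} (u(t), v(t))₀ dt`, where `(·,·)₀` is the Killing form. -/
def Loop.form (u v : Loop σ) : 𝕜 :=
  ∫ t in (0 : ℝ)..(2 * Real.pi), killingForm 𝕜 g (u.1 t) (v.1 t)

namespace Loop

theorem deriv_apply (u : Loop σ) (t : ℝ) : u.deriv.1 t = curveDeriv 𝕜 u.1 t := rfl

theorem deriv_add (u v : Loop σ) : (u + v).deriv = u.deriv + v.deriv :=
  Subtype.ext <| funext fun t => curveDeriv_add u.2.1 v.2.1 t

theorem deriv_smul (a : 𝕜) (u : Loop σ) : (a • u).deriv = a • u.deriv :=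
  Subtype.ext <| funext fun t => curveDeriv_smul a u.2.1 t

theorem deriv_lie (u v : Loop σ) : ⁅u, v⁆.deriv = ⁅u.deriv, v⁆ + ⁅u, v.deriv⁆ :=
  Subtype.ext <| funext fun t => curveDeriv_lie u.2.1 v.2.1 t

theorem intervalIntegrable_killing (u v : Loop σ) (a b : ℝ) :
    IntervalIntegrable (fun t => killingForm 𝕜 g (u.1 t) (v.1 t)) MeasureTheory.volume a b :=
  (contDiff_bilin (killingForm 𝕜 g) u.2.1 v.2.1).continuous.intervalIntegrable a b

theorem form_add_left (u v w : Loop σ) : form (u + v) w = form u w + form v w := by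
  simp only [form]
  rw [← intervalIntegral.integral_add (intervalIntegrable_killing u w _ _)
    (intervalIntegrable_killing v w _ _)]
  simp

theorem form_smul_left (a : 𝕜) (u w : Loop σ) : form (a • u) w = a * form u w := by
  simp only [form]
  rw [← intervalIntegral.integral_const_mul]
  simp

theorem form_comm (u w : Loop σ) : form u w = form w u := by
  simp only [form]
  exact intervalIntegral.integral_congr fun t _ => LieModule.traceForm_comm 𝕜 g g _ _

theorem form_add_right (u v w : Loop σ) : form u (v + w) = form u v + form u w := by
  rw [form_comm, form_add_left, form_comm v, form_comm w]

theorem form_smul_right (a : 𝕜) (u w : Loop σ) : form u (a • w) = a * form u w := by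
  rw [form_comm, form_smul_left, form_comm w]

theorem form_lie (u v w : Loop σ) : form ⁅u, v⁆ w = form u ⁅v, w⁆ := by
  simp only [form]
  exact intervalIntegral.integral_congr fun t _ =>
    LieModule.traceForm_apply_lie_apply 𝕜 g g _ _ _

theorem form_deriv (u v : Loop σ) : form u.deriv v + form u v.deriv = 0 := by
  have h := intervalIntegral.integral_eq_sub_of_hasDerivAt
    (fun t (_ : t ∈ Set.uIcc (0 : ℝ) (2 * Real.pi)) =>
      hasDerivAt_bilin (killingForm 𝕜 g) u.2.1 v.2.1 t)
    ((intervalIntegrable_killing u.deriv v _ _).add (intervalIntegrable_killing u v.deriv _ _))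
  rw [form, form, ← intervalIntegral.integral_add (intervalIntegrable_killing u.deriv v _ _)
    (intervalIntegrable_killing u v.deriv _ _)]
  refine h.trans ?_
  have h0 : ∀ w : Loop σ, w.1 (2 * Real.pi) = σ (w.1 0) := fun w => by
    have := w.2.2 0
    rwa [zero_add] at this
  rw [h0 u, h0 v, LieAlgebra.killingForm_of_equiv_apply, sub_self]

end Loop

end LoopAlgebra

/-- The affine Kac–Moody algebra `L(g, σ) + 𝕜 c + 𝕜 d`: the element `⟨u, a, b⟩` is
`u + a c + b d`. -/
@[ext]
structure Affine (σ : g ≃ₗ⁅𝕜⁆ g) where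
  /-- the component in the loop algebra -/
  loop : Loop σ
  /-- the coefficient of `c` -/
  coeffC : 𝕜
  /-- the coefficient of `d` -/
  coeffD : 𝕜

namespace Affine

variable {σ : g ≃ₗ⁅𝕜⁆ g}

/-- The decomposition as a vector space. -/
def equivProd (σ : g ≃ₗ⁅𝕜⁆ g) : Affine σ ≃ Loop σ × 𝕜 × 𝕜 where
  toFun x := (x.loop, x.coeffC, x.coeffD)
  invFun p := ⟨p.1, p.2.1, p.2.2⟩
  left_inv _ := rfl
  right_inv _ := rfl

instance : AddCommGroup (Affine σ) := (equivProd σ).addCommGroup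

instance : Module 𝕜 (Affine σ) := (equivProd σ).module 𝕜

@[simp] theorem add_loop (x y : Affine σ) : (x + y).loop = x.loop + y.loop := rfl
@[simp] theorem add_coeffC (x y : Affine σ) : (x + y).coeffC = x.coeffC + y.coeffC := rfl
@[simp] theorem add_coeffD (x y : Affine σ) : (x + y).coeffD = x.coeffD + y.coeffD := rfl
@[simp] theorem smul_loop (a : 𝕜) (x : Affine σ) : (a • x).loop = a • x.loop := rfl
@[simp] theorem smul_coeffC (a : 𝕜) (x : Affine σ) : (a • x).coeffC = a * x.coeffC := rfl
@[simp] theorem smul_coeffD (a : 𝕜) (x : Affine σ) : (a • x).coeffD = a * x.coeffD := rfl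
@[simp] theorem zero_loop : (0 : Affine σ).loop = 0 := rfl
@[simp] theorem zero_coeffC : (0 : Affine σ).coeffC = 0 := rfl
@[simp] theorem zero_coeffD : (0 : Affine σ).coeffD = 0 := rfl

/-- The inclusion `L(g, σ) → L(g, σ) + 𝕜 c + 𝕜 d` of vector spaces. -/
def ofLoop (u : Loop σ) : Affine σ := ⟨u, 0, 0⟩

/-- The generator `c`. -/
def c (σ : g ≃ₗ⁅𝕜⁆ g) : Affine σ := ⟨0, 1, 0⟩

/-- The generator `d`. -/
def d (σ : g ≃ₗ⁅𝕜⁆ g) : Affine σ := ⟨0, 0, 1⟩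

variable [FiniteDimensional 𝕜 g]

/-- The bracket determined by `[u, v] = [u, v]₀ + (u', v) c`, `[d, u] = u'` and `[c, x] = 0`. -/
instance : Bracket (Affine σ) (Affine σ) where
  bracket x y := ⟨⁅x.loop, y.loop⁆ + x.coeffD • y.loop.deriv - y.coeffD • x.loop.deriv,
    Loop.form x.loop.deriv y.loop, 0⟩

@[simp] theorem lie_loop (x y : Affine σ) : ⁅x, y⁆.loop =
    ⁅x.loop, y.loop⁆ + x.coeffD • y.loop.deriv - y.coeffD • x.loop.deriv := rfl
@[simp] theorem lie_coeffC (x y : Affine σ) :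
    ⁅x, y⁆.coeffC = Loop.form x.loop.deriv y.loop := rfl
@[simp] theorem lie_coeffD (x y : Affine σ) : ⁅x, y⁆.coeffD = 0 := rfl

theorem form_deriv_self (u : Loop σ) : Loop.form u.deriv u = 0 := by
  have h := Loop.form_deriv u u
  rw [Loop.form_comm u u.deriv, ← two_mul] at h
  simpa using h

instance : LieRing (Affine σ) where
  add_lie x y z := by
    ext1
    · simp only [lie_loop, add_loop, add_coeffD, add_lie, Loop.deriv_add, smul_add, add_smul]
      abel
    · simp only [lie_coeffC, add_loop, add_coeffC, Loop.deriv_add, Loop.form_add_left]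
    · simp
  lie_add x y z := by
    ext1
    · simp only [lie_loop, add_loop, add_coeffD, lie_add, Loop.deriv_add, smul_add, add_smul]
      abel
    · simp only [lie_coeffC, add_loop, add_coeffC, Loop.form_add_right]
    · simp
  lie_self x := by
    ext1
    · simp
    · simp [form_deriv_self]
    · simp
  leibniz_lie x y z := by
    have hneg : ∀ u : Loop σ, -u = (-1 : 𝕜) • u := fun u => by simp
    ext1
    · simp only [lie_loop, add_loop, lie_coeffD, sub_eq_add_neg, hneg, Loop.deriv_add,
        Loop.deriv_smul, Loop.deriv_lie, lie_add, add_lie, lie_smul, smul_lie, smul_add, smul_smul,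
        zero_smul, smul_zero, leibniz_lie x.loop y.loop z.loop]
      rw [← lie_skew y.loop x.loop.deriv]
      module
    · simp only [lie_coeffC, add_coeffC, lie_loop, sub_eq_add_neg, hneg, Loop.deriv_add,
        Loop.deriv_smul, Loop.deriv_lie, Loop.form_add_left, Loop.form_add_right,
        Loop.form_smul_left, Loop.form_smul_right]
      have e1 := Loop.form_deriv x.loop.deriv z.loop
      have e2 := Loop.form_deriv y.loop.deriv z.loop
      have e4 := Loop.form_lie x.loop.deriv y.loop z.loop
      have e5 := Loop.form_lie y.loop.deriv x.loop z.loop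
      have e6 : Loop.form ⁅x.loop, y.loop.deriv⁆ z.loop
          = - Loop.form ⁅y.loop.deriv, x.loop⁆ z.loop := by
        rw [← lie_skew, hneg, Loop.form_smul_left, neg_one_mul]
      have e7 := Loop.form_comm y.loop.deriv x.loop.deriv
      linear_combination -e4 + e5 - e6 + y.coeffD * e1 - x.coeffD * e2 + z.coeffD * e7
    · simp

instance : LieAlgebra 𝕜 (Affine σ) where
  lie_smul a x y := by
    ext1
    · simp only [lie_loop, smul_loop, smul_coeffD, lie_smul, Loop.deriv_smul]
      module
    · simp [Loop.form_smul_right]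
    · simp

end Affine

section Isomorphisms

variable [FiniteDimensional 𝕜 g] {σ τ : g ≃ₗ⁅𝕜⁆ g}

/-- `g` is a simple Lie algebra over `𝕜 = ℝ` or `ℂ` (non-abelian, without proper ideals), which is
moreover compact, i.e. has negative definite Killing form, when `𝕜 = ℝ`
(that is, when `RCLike.I = 0`). -/
def SimpleCompactIfReal (𝕜 : Type*) [RCLike 𝕜] (g : Type*) [LieRing g] [LieAlgebra 𝕜 g] : Prop :=
  LieAlgebra.IsSimple 𝕜 g ∧
    ((RCLike.I : 𝕜) = 0 → ∀ x : g, x ≠ 0 → RCLike.re (killingForm 𝕜 g x x) < 0)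

/-- `φ̂` induces `φ` (or extends `φ`): `φ̂` maps the derived algebra `L(g, σ) + 𝕜 c` to the
derived algebra of the target and there, modulo the centre `𝕜 c`, it is `φ`. -/
def Induces (φhat : Affine σ ≃ₗ⁅𝕜⁆ Affine τ) (φ : Loop σ ≃ₗ⁅𝕜⁆ Loop τ) : Prop :=
  ∀ x ∈ LieAlgebra.derivedSeries 𝕜 (Affine σ) 1, (φhat x).loop = φ x.loop

/-- A curve `t ↦ φ_t` of Lie algebra automorphisms is smooth. -/
def SmoothAutCurve (Φ : ℝ → (g ≃ₗ⁅𝕜⁆ g)) : Prop :=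
  ∀ x : g, SmoothCurve 𝕜 (fun t => Φ t x)

/-- `φ` is the standard isomorphism `φ u (t) = φ_t (u (lam t))`, where `φ_t` is a smooth curve of
automorphisms, `lam` is a diffeomorphism of the real line with
`lam (t + 2π) = lam t + ε 2π`, and `φ_{t + 2π} = τ φ_t σ^{-ε}`. -/
structure IsStandard (φ : Loop σ ≃ₗ⁅𝕜⁆ Loop τ) (Φ : ℝ → (g ≃ₗ⁅𝕜⁆ g)) (lam : ℝ → ℝ)
    (ε : ℤˣ) : Prop where
  smooth_aut : SmoothAutCurve Φ
  smooth_lam : ContDiff ℝ ∞ lam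
  diffeo : ∃ inv : ℝ → ℝ, ContDiff ℝ ∞ inv ∧ Function.LeftInverse inv lam ∧
    Function.RightInverse inv lam
  lam_period : ∀ t, lam (t + 2 * Real.pi) = lam t + ((ε : ℤ) : ℝ) * (2 * Real.pi)
  aut_period : ∀ t x, Φ (t + 2 * Real.pi) x =
    τ (Φ t (((σ.toLinearEquiv : g ≃ₗ[𝕜] g) ^ (-(ε : ℤ))) x))
  apply_eq : ∀ (u : Loop σ) (t : ℝ), (φ u).1 t = Φ t (u.1 (lam t))

/-- The endomorphism `φ_t' ∘ φ_t⁻¹` of `g`, applied to `x`. -/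
def logDeriv (Φ : ℝ → (g ≃ₗ⁅𝕜⁆ g)) (t : ℝ) (x : g) : g :=
  curveDeriv 𝕜 (fun s => Φ s ((Φ t).symm x)) t

/-- The equation `ad u_φ = -ε φ_t' φ_t⁻¹`. -/
def AdEquation (Φ : ℝ → (g ≃ₗ⁅𝕜⁆ g)) (ε : ℤˣ) (w : Loop τ) : Prop :=
  ∀ (t : ℝ) (x : g), ⁅w.1 t, x⁆ = -(((ε : ℤ) : 𝕜) • logDeriv Φ t x)

end Isomorphisms

end KacMoody

end

/-!
The affine algebra determines its centre `𝕜 c` and its derived algebra, and the loop algebra is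
perfect: by a partition of unity on the circle it is spanned by brackets of loops that are supported
in short intervals, where the perfectness of `g` applies. So an isomorphism `φhat` of affine
algebras descends to a unique isomorphism `φ` of loop algebras, and comparing brackets with `d`
gives `φ u' = [w, φ u] + α (φ u)'`, where `w` and `α` are the loop component and the `d`-coefficient
of `φhat d` (`Affine.map_deriv_of_induces`).

For fixed `t`, the map `u ↦ φ u (t)` is a homomorphism of the loop algebra onto `g`. Its kernel is
stable under multiplication by periodic functions because `g` has no centre. By compactness of the
circle the functions annihilating the quotient have a common zero `s`, and every function vanishing
at `s` annihilates the quotient: otherwise it would act invertibly on it, and its characteristic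
polynomial would yield an annihilating function that is nonzero at `s`. Writing a loop near `s` in
a basis of `g`, one concludes `φ u (t) = φ_t (u (λ t))` for an automorphism `φ_t` of `g`
(`exists_eval_of_surjective`). Inserting `f u` into the identity for `φ u'` gives
`f' ∘ λ = α (f ∘ λ)'` for every periodic function `f`. For `f = sin, cos` this is a linear
differential equation with constant coefficients, whose solutions show that `λ` is affine with
slope `α⁻¹` modulo `2π` (`exists_affine_mod_period`). The slope is an integer by periodicity, and
so is the slope `α` of the inverse of `φ`; hence it is `±1`.

Conversely, by Cartan's criterion the Killing form of `g` is nondegenerate, so the derivation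
`-ε φ_t' φ_t⁻¹` is inner, given by a unique loop `w` (`existsUnique_adEquation`). Differentiating
`φ u (t) = φ_t (u (ε t + t₀))` yields `φ u' = [w, φ u] + ε (φ u)'`, and `φ` is an isometry; the
explicit formulas then define an extension (`extensionEquiv`). Any extension has the same values:
its value on `d` is determined up to a multiple of `c` since no nonzero multiple of `d` acts on
loops as an inner derivation. If `φhat c = γ c`, the difference of the `c`-coefficients on loops is
a functional `δ` with `δ [u, v] = (ε - γ) (u', v)`; this forces `γ = ε`, as there are commuting
loops `u` and `f u` with `(u', f u) ≠ 0`, and then `δ = 0` by perfectness (`coeffC_of_induces`).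
-/

noncomputable section

namespace KacMoody

/-! ### Twisted periodic extension -/

section TwistedExtension

variable {𝕜 : Type*} [RCLike 𝕜] {V : Type*} [AddCommGroup V] [Module 𝕜 V]

/-- The integer `n` for which `t - 2πn` lies in the window `[s - π, s + π)`. -/
def windowIndex (s t : ℝ) : ℤ := ⌊(t - s + Real.pi) / (2 * Real.pi)⌋

theorem windowIndex_spec (s t : ℝ) :
    s - Real.pi ≤ t - 2 * Real.pi * windowIndex s t ∧
      t - 2 * Real.pi * windowIndex s t < s + Real.pi := by
  have hp := Real.two_pi_pos
  have h1 := Int.floor_le ((t - s + Real.pi) / (2 * Real.pi))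
  have h2 := Int.lt_floor_add_one ((t - s + Real.pi) / (2 * Real.pi))
  rw [le_div_iff₀ hp] at h1
  rw [div_lt_iff₀ hp] at h2
  unfold windowIndex
  constructor <;> linarith

theorem abs_window_le (s t : ℝ) : |t - 2 * Real.pi * windowIndex s t - s| ≤ Real.pi := by
  have := windowIndex_spec s t
  rw [abs_le]
  constructor <;> linarith

theorem windowIndex_add_period (s t : ℝ) :
    windowIndex s (t + 2 * Real.pi) = windowIndex s t + 1 := by
  have hp := Real.two_pi_pos
  unfold windowIndex
  rw [← Int.floor_add_one]
  congr 1
  field_simp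
  ring

/-- The extension of the restriction of `h` to `[s - π, s + π)` to a function `E` on the line with
`E (t + 2π) = T (E t)`. -/
def twistedExtend (T : V ≃ₗ[𝕜] V) (s : ℝ) (h : ℝ → V) (t : ℝ) : V :=
  (T ^ windowIndex s t) (h (t - 2 * Real.pi * windowIndex s t))

theorem twistedExtend_add_period (T : V ≃ₗ[𝕜] V) (s : ℝ) (h : ℝ → V) (t : ℝ) :
    twistedExtend T s h (t + 2 * Real.pi) = T (twistedExtend T s h t) := by
  unfold twistedExtend
  rw [windowIndex_add_period, add_comm, zpow_one_add, LinearEquiv.mul_apply]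
  congr 3
  push_cast
  ring

/-- For `h` supported in `[s - 3, s + 3]`, the extension agrees with the translate of `h` by `2πm`
on the interval of radius `2π - 3 > π` about `s + 2πm`. -/
theorem twistedExtend_eq (T : V ≃ₗ[𝕜] V) {s : ℝ} {h : ℝ → V}
    (hh : ∀ t, 3 ≤ |t - s| → h t = 0) (m : ℤ) {t : ℝ}
    (ht : |t - 2 * Real.pi * m - s| < 2 * Real.pi - 3) :
    twistedExtend T s h t = (T ^ m) (h (t - 2 * Real.pi * m)) := by
  have hp := Real.pi_gt_three
  by_cases hm : windowIndex s t = m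
  · rw [twistedExtend, hm]
  have h1 : (1 : ℝ) ≤ |((windowIndex s t : ℤ) : ℝ) - m| := by
    exact_mod_cast Int.one_le_abs (sub_ne_zero.2 hm)
  have h2 := abs_window_le s t
  have h3 : 2 * Real.pi ≤ |t - 2 * Real.pi * windowIndex s t - s|
      + |t - 2 * Real.pi * m - s| := by
    calc 2 * Real.pi ≤ 2 * Real.pi * |((windowIndex s t : ℤ) : ℝ) - m| := by nlinarith
      _ = |(t - 2 * Real.pi * m - s) - (t - 2 * Real.pi * windowIndex s t - s)| := by
        rw [← abs_of_pos Real.two_pi_pos, ← abs_mul, abs_of_pos Real.two_pi_pos]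
        congr 1
        ring
      _ ≤ _ := (abs_sub _ _).trans_eq (add_comm _ _)
  rw [twistedExtend, hh _ (by linarith), hh (t - 2 * Real.pi * m) (by linarith), map_zero, map_zero]

theorem twistedExtend_apply (T : V ≃ₗ[𝕜] V) {s : ℝ} {h : ℝ → V}
    (hh : ∀ t, 3 ≤ |t - s| → h t = 0) {t : ℝ} (ht : |t - s| < 2 * Real.pi - 3) :
    twistedExtend T s h t = h t := by
  simpa using twistedExtend_eq T hh 0 (t := t) (by simpa using ht)

theorem contDiff_twistedExtend (T : V ≃ₗ[𝕜] V) {s : ℝ} {h : ℝ → V}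
    (hh : ∀ t, 3 ≤ |t - s| → h t = 0)
    (hs : ∀ l : Module.Dual 𝕜 V, ContDiff ℝ ∞ fun t => l (h t)) (l : Module.Dual 𝕜 V) :
    ContDiff ℝ ∞ fun t => l (twistedExtend T s h t) := by
  rw [contDiff_iff_contDiffAt]
  intro t
  set m := windowIndex s t
  have hsm : ContDiff ℝ ∞ fun t => l ((T ^ m) (h (t - 2 * Real.pi * m))) :=
    (hs (l ∘ₗ ((T ^ m : V ≃ₗ[𝕜] V) : V →ₗ[𝕜] V))).comp (contDiff_id.sub contDiff_const)
  refine hsm.contDiffAt.congr_of_eventuallyEq ?_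
  have hopen : ∀ᶠ t' in nhds t, |t' - 2 * Real.pi * m - s| < 2 * Real.pi - 3 := by
    refine ContinuousAt.eventually_lt (by fun_prop) continuousAt_const ?_
    have := abs_window_le s t
    have := Real.pi_gt_three
    change |t - 2 * Real.pi * (windowIndex s t : ℤ) - s| < _
    linarith
  filter_upwards [hopen] with t' ht'
  rw [twistedExtend_eq T hh m ht']

/-- A smooth function equal to `1` on `[s - 2, s + 2]` and vanishing outside `(s - 3, s + 3)`. -/
def cutoff (s : ℝ) : ContDiffBump s := ⟨2, 3, by norm_num, by norm_num⟩

theorem cutoff_eq_one {s t : ℝ} (h : |t - s| ≤ 2) : cutoff s t = 1 :=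
  (cutoff s).one_of_mem_closedBall (by simpa [Real.dist_eq, cutoff] using h)

theorem cutoff_eq_zero {s t : ℝ} (h : 3 ≤ |t - s|) : cutoff s t = 0 :=
  (cutoff s).zero_of_le_dist (by simpa [Real.dist_eq, cutoff] using h)

theorem contDiff_cutoff (𝕜 : Type*) [RCLike 𝕜] (s : ℝ) :
    ContDiff ℝ ∞ fun t => ((cutoff s t : ℝ) : 𝕜) :=
  (RCLike.ofRealCLM (K := 𝕜)).contDiff.comp ((cutoff s).contDiff (n := ⊤))

/-- The twisted periodic extension of `h`, cut off around `s`. -/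
def localExtend (T : V ≃ₗ[𝕜] V) (s : ℝ) (h : ℝ → V) : ℝ → V :=
  twistedExtend T s fun t => ((cutoff s t : ℝ) : 𝕜) • h t

theorem localExtend_apply (T : V ≃ₗ[𝕜] V) {s : ℝ} (h : ℝ → V) {t : ℝ} (ht : |t - s| ≤ Real.pi) :
    localExtend T s h t = ((cutoff s t : ℝ) : 𝕜) • h t := by
  have := Real.pi_gt_three
  exact twistedExtend_apply T (fun t ht => by simp [cutoff_eq_zero ht]) (by linarith)

theorem contDiff_localExtend (T : V ≃ₗ[𝕜] V) (s : ℝ) {h : ℝ → V}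
    (hs : ∀ l : Module.Dual 𝕜 V, ContDiff ℝ ∞ fun t => l (h t)) (l : Module.Dual 𝕜 V) :
    ContDiff ℝ ∞ fun t => l (localExtend T s h t) :=
  contDiff_twistedExtend T (fun t ht => by simp [cutoff_eq_zero ht])
    (fun l => by simpa using (contDiff_cutoff 𝕜 s).mul (hs l)) l

end TwistedExtension

/-! ### Multiplying loops by periodic functions -/

/-- The algebra of smooth `2π`-periodic scalar functions. -/
def periodicAlgebra (𝕜 : Type*) [RCLike 𝕜] : Subalgebra 𝕜 (ℝ → 𝕜) where
  carrier := {f | ContDiff ℝ ∞ f ∧ ∀ t, f (t + 2 * Real.pi) = f t}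
  mul_mem' := fun {f k} hf hk => ⟨hf.1.mul hk.1, fun t => by simp [hf.2 t, hk.2 t]⟩
  add_mem' := fun {f k} hf hk => ⟨hf.1.add hk.1, fun t => by simp [hf.2 t, hk.2 t]⟩
  algebraMap_mem' := fun _ => ⟨contDiff_const, fun _ => rfl⟩

theorem periodic_int {𝕜 : Type*} [RCLike 𝕜] (f : periodicAlgebra 𝕜) (t : ℝ) (n : ℤ) :
    f.1 (t - 2 * Real.pi * n) = f.1 t := by
  have h : Function.Periodic f.1 (2 * Real.pi) := f.2.2
  rw [mul_comm]
  exact h.sub_int_mul_eq n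

theorem periodic_ext {𝕜 : Type*} [RCLike 𝕜] {f k : periodicAlgebra 𝕜} (s : ℝ)
    (h : ∀ t, |t - s| ≤ Real.pi → f.1 t = k.1 t) : f = k := by
  refine Subtype.ext (funext fun t => ?_)
  rw [← periodic_int f t (windowIndex s t), ← periodic_int k t (windowIndex s t)]
  exact h _ (abs_window_le s t)

/-- The `2π`-periodic function which near `s` is the product of `f` with a cut-off function. -/
def localFun {𝕜 : Type*} [RCLike 𝕜] (s : ℝ) (f : ℝ → 𝕜) (hf : ContDiff ℝ ∞ f) :
    periodicAlgebra 𝕜 :=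
  ⟨localExtend (LinearEquiv.refl 𝕜 𝕜) s f,
    contDiff_localExtend _ s (fun l => by
      have : (fun t => l (f t)) = fun t => f t * l 1 := funext fun t => by
        rw [← smul_eq_mul, ← map_smul, smul_eq_mul, mul_one]
      rw [this]
      exact hf.mul contDiff_const) LinearMap.id,
    fun t => twistedExtend_add_period _ s _ t⟩

theorem localFun_apply {𝕜 : Type*} [RCLike 𝕜] {s : ℝ} {f : ℝ → 𝕜} (hf : ContDiff ℝ ∞ f) {t : ℝ}
    (ht : |t - s| ≤ Real.pi) : (localFun s f hf).1 t = ((cutoff s t : ℝ) : 𝕜) * f t :=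
  localExtend_apply _ _ ht

variable {𝕜 : Type*} [RCLike 𝕜] {g : Type*} [LieRing g] [LieAlgebra 𝕜 g]
  {σ τ : g ≃ₗ⁅𝕜⁆ g}

namespace Loop

theorem apply_add_int (u : Loop σ) (t : ℝ) (n : ℤ) :
    u.1 (t + 2 * Real.pi * n) = (σ.toLinearEquiv ^ n) (u.1 t) := by
  induction n using Int.induction_on with
  | zero => simp
  | succ n ih =>
    rw [show t + 2 * Real.pi * ((n + 1 : ℤ) : ℝ) = (t + 2 * Real.pi * (n : ℤ)) + 2 * Real.pi by
      push_cast; ring, u.2.2, ih, add_comm, zpow_one_add]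
    rfl
  | pred n ih =>
    have h := u.2.2 (t + 2 * Real.pi * ((-n - 1 : ℤ) : ℝ))
    rw [show t + 2 * Real.pi * ((-n - 1 : ℤ) : ℝ) + 2 * Real.pi
      = t + 2 * Real.pi * ((-n : ℤ) : ℝ) by push_cast; ring, ih,
      show σ.toLinearEquiv ^ (-n : ℤ) = σ.toLinearEquiv * σ.toLinearEquiv ^ (-n - 1 : ℤ) by
        rw [← zpow_one_add]; congr 1; ring] at h
    exact (σ.toLinearEquiv.injective h).symm

theorem ext_window {u v : Loop σ} (s : ℝ)
    (h : ∀ t, |t - s| ≤ Real.pi → u.1 t = v.1 t) : u = v := by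
  refine Subtype.ext (funext fun t => ?_)
  have ht : t = (t - 2 * Real.pi * windowIndex s t) + 2 * Real.pi * windowIndex s t := by ring
  rw [ht, apply_add_int, apply_add_int, h _ (abs_window_le s t)]

/-- The loop which near `s` is the product of `h` with a cut-off function. -/
def localize (σ : g ≃ₗ⁅𝕜⁆ g) (s : ℝ) (h : ℝ → g) (hs : SmoothCurve 𝕜 h) : Loop σ :=
  ⟨localExtend σ.toLinearEquiv s h, contDiff_localExtend _ s hs, twistedExtend_add_period _ s _⟩

theorem localize_apply {s : ℝ} {h : ℝ → g} (hs : SmoothCurve 𝕜 h) {t : ℝ}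
    (ht : |t - s| ≤ Real.pi) :
    (localize σ s h hs).1 t = ((cutoff s t : ℝ) : 𝕜) • h t :=
  localExtend_apply _ _ ht

theorem smoothCurve_const (x : g) : SmoothCurve 𝕜 (fun _ : ℝ => x) := fun _ => contDiff_const

/-- A loop that is constantly equal to `x` near `s`. -/
def localConst (σ : g ≃ₗ⁅𝕜⁆ g) (s : ℝ) (x : g) : Loop σ :=
  localize σ s (fun _ => x) (smoothCurve_const x)

theorem localConst_apply {s t : ℝ} (x : g) (ht : |t - s| ≤ 2) : (localConst σ s x).1 t = x := by
  have := Real.pi_gt_three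
  rw [localConst, localize_apply _ (by linarith), cutoff_eq_one ht]
  simp

theorem localConst_apply_self (s : ℝ) (x : g) : (localConst σ s x).1 s = x :=
  localConst_apply x (by simp)

/-- The product of a loop with a periodic function. -/
def mulFun (f : periodicAlgebra 𝕜) (u : Loop σ) : Loop σ :=
  ⟨fun t => f.1 t • u.1 t, fun l => by simpa using f.2.1.mul (u.2.1 l), fun t => by
    simp [f.2.2 t, u.2.2 t]⟩

theorem mulFun_apply (f : periodicAlgebra 𝕜) (u : Loop σ) (t : ℝ) :
    (mulFun f u).1 t = f.1 t • u.1 t := rfl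

theorem add_mulFun (f k : periodicAlgebra 𝕜) (u : Loop σ) :
    mulFun (f + k) u = mulFun f u + mulFun k u :=
  Subtype.ext <| funext fun t => add_smul (f.1 t) (k.1 t) (u.1 t)

theorem mul_mulFun (f k : periodicAlgebra 𝕜) (u : Loop σ) :
    mulFun (f * k) u = mulFun f (mulFun k u) :=
  Subtype.ext <| funext fun t => mul_smul (f.1 t) (k.1 t) (u.1 t)

theorem smul_mulFun (a : 𝕜) (f : periodicAlgebra 𝕜) (u : Loop σ) :
    mulFun (a • f) u = a • mulFun f u :=
  Subtype.ext <| funext fun t => smul_assoc a (f.1 t) (u.1 t)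

theorem one_mulFun (u : Loop σ) : mulFun 1 u = u :=
  Subtype.ext <| funext fun t => one_smul 𝕜 (u.1 t)

theorem mulFun_add (f : periodicAlgebra 𝕜) (u v : Loop σ) :
    mulFun f (u + v) = mulFun f u + mulFun f v :=
  Subtype.ext <| funext fun t => smul_add (f.1 t) (u.1 t) (v.1 t)

theorem mulFun_smul (f : periodicAlgebra 𝕜) (a : 𝕜) (u : Loop σ) :
    mulFun f (a • u) = a • mulFun f u :=
  Subtype.ext <| funext fun t => smul_comm (f.1 t) a (u.1 t)

variable [FiniteDimensional 𝕜 g]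

theorem lie_mulFun (f : periodicAlgebra 𝕜) (u v : Loop σ) :
    ⁅u, mulFun f v⁆ = mulFun f ⁅u, v⁆ :=
  Subtype.ext <| funext fun t => lie_smul (f.1 t) (u.1 t) (v.1 t)

theorem mulFun_lie (f : periodicAlgebra 𝕜) (u v : Loop σ) :
    ⁅mulFun f u, v⁆ = mulFun f ⁅u, v⁆ :=
  Subtype.ext <| funext fun t => smul_lie (f.1 t) (u.1 t) (v.1 t)

end Loop

/-! ### Perfectness -/

/-- The square of the periodic cut-off function around `s`. -/
def cutoffSq (𝕜 : Type*) [RCLike 𝕜] (s : ℝ) : periodicAlgebra 𝕜 :=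
  localFun s (fun _ => 1) contDiff_const * localFun s (fun _ => 1) contDiff_const

theorem cutoffSq_apply {s t : ℝ} (ht : |t - s| ≤ Real.pi) :
    (cutoffSq 𝕜 s).1 t = ((cutoff s t : ℝ) : 𝕜) * ((cutoff s t : ℝ) : 𝕜) := by
  have h := localFun_apply (𝕜 := 𝕜) (s := s) (f := fun _ => 1) contDiff_const ht
  rw [mul_one] at h
  rw [← h]
  rfl

theorem cutoffSq_apply_self (s : ℝ) : (cutoffSq 𝕜 s).1 s = 1 := by
  rw [cutoffSq_apply (by simp [Real.pi_pos.le]), cutoff_eq_one (by simp)]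
  simp

/-- The cut-off functions around `0` and `π` yield a partition of unity of the circle. -/
theorem partition_of_unity :
    cutoffSq 𝕜 0 + cutoffSq 𝕜 Real.pi * (1 - cutoffSq 𝕜 0) = 1 := by
  have hp := Real.pi_gt_three
  have hp4 := Real.pi_le_four
  refine periodic_ext Real.pi fun t ht => ?_
  change (cutoffSq 𝕜 0).1 t + (cutoffSq 𝕜 Real.pi).1 t * (1 - (cutoffSq 𝕜 0).1 t) = 1
  by_cases h2 : |t - Real.pi| ≤ 2
  · rw [cutoffSq_apply (s := Real.pi) ht, cutoff_eq_one h2]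
    simp
  suffices h : (cutoffSq 𝕜 0).1 t = 1 by rw [h]; simp
  have h0 : ∀ r : ℝ, |r| ≤ 2 → (cutoffSq 𝕜 0).1 r = 1 := fun r hr => by
    rw [cutoffSq_apply (by rw [sub_zero]; linarith), cutoff_eq_one (by simpa using hr)]
    simp
  rw [not_le, lt_abs] at h2
  rw [abs_le] at ht
  rcases h2 with h2 | h2
  · rw [← periodic_int _ t 1]
    refine h0 _ ?_
    push_cast
    rw [abs_le]
    constructor <;> linarith
  · refine h0 _ ?_
    rw [abs_le]
    constructor <;> linarith

theorem SmoothCurve.linearMap_comp {V : Type*} [LieRing V] [LieAlgebra 𝕜 V] {u : ℝ → g}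
    (hu : SmoothCurve 𝕜 u) (A : g →ₗ[𝕜] V) : SmoothCurve 𝕜 fun t => A (u t) :=
  fun l => hu (l ∘ₗ A)

section Perfect

variable [FiniteDimensional 𝕜 g]

/-- Near a point, a loop is a combination of constant loops with function coefficients. -/
theorem Loop.cutoffSq_mulFun_eq_sum (s : ℝ) (u : Loop σ) :
    Loop.mulFun (cutoffSq 𝕜 s) u = ∑ i, Loop.mulFun
      (localFun s (fun t => (Module.finBasis 𝕜 g).repr (u.1 t) i)
        (smoothCurve_iff_repr.1 u.2.1 i))
      (Loop.localConst σ s (Module.finBasis 𝕜 g i)) := by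
  refine Loop.ext_window s fun t ht => ?_
  rw [Submodule.coe_sum, Finset.sum_apply, Loop.mulFun_apply, cutoffSq_apply ht]
  simp only [Loop.mulFun_apply, localFun_apply _ ht, Loop.localConst, Loop.localize_apply _ ht,
    smul_smul]
  conv_lhs => rw [← (Module.finBasis 𝕜 g).sum_repr (u.1 t)]
  rw [Finset.smul_sum]
  refine Finset.sum_congr rfl fun i _ => ?_
  rw [smul_smul]
  congr 1
  ring

/-- In a perfect Lie algebra there are linear maps `a i` with `x = ∑ i, ⁅a i x, e i⁆` for a
basis `e`. -/
theorem exists_lie_section (hp : LieAlgebra.derivedSeries 𝕜 g 1 = ⊤) :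
    ∃ a : Fin (Module.finrank 𝕜 g) → g →ₗ[𝕜] g,
      ∀ x, x = ∑ i, ⁅a i x, Module.finBasis 𝕜 g i⁆ := by
  let S : (Fin (Module.finrank 𝕜 g) → g) →ₗ[𝕜] g :=
    ∑ i, -(LieAlgebra.ad 𝕜 g (Module.finBasis 𝕜 g i) ∘ₗ LinearMap.proj i)
  have hS : ∀ y, S y = ∑ i, ⁅y i, Module.finBasis 𝕜 g i⁆ := fun y => by
    simp only [S, LinearMap.sum_apply, LinearMap.neg_apply, LinearMap.comp_apply,
      LinearMap.proj_apply, LieAlgebra.ad_apply, lie_skew]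
  have hsurj : Function.Surjective S := by
    rw [← LinearMap.range_eq_top, eq_top_iff]
    have h1 : (LieAlgebra.derivedSeries 𝕜 g 1 : LieIdeal 𝕜 g).toSubmodule = ⊤ := by
      rw [hp]; rfl
    rw [← h1, LieAlgebra.derivedSeries_def, LieAlgebra.derivedSeriesOfIdeal_succ,
      LieAlgebra.derivedSeriesOfIdeal_zero, LieSubmodule.lieIdeal_oper_eq_linear_span',
      Submodule.span_le]
    rintro _ ⟨x, -, y, -, rfl⟩
    refine ⟨fun i => (Module.finBasis 𝕜 g).repr y i • x, ?_⟩
    rw [hS]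
    conv_rhs => rw [← (Module.finBasis 𝕜 g).sum_repr y]
    rw [lie_sum]
    simp
  obtain ⟨A, hA⟩ := LinearMap.exists_rightInverse_of_surjective S (LinearMap.range_eq_top.2 hsurj)
  refine ⟨fun i => LinearMap.proj i ∘ₗ A, fun x => ?_⟩
  have := LinearMap.congr_fun hA x
  rw [LinearMap.comp_apply, hS] at this
  exact this.symm

/-- If `g` is perfect, then the loop algebra is spanned by brackets. -/
theorem Loop.span_lie_eq_top (hp : LieAlgebra.derivedSeries 𝕜 g 1 = ⊤) :
    Submodule.span 𝕜 {w : Loop σ | ∃ u v : Loop σ, ⁅u, v⁆ = w} = ⊤ := by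
  obtain ⟨a, ha⟩ := exists_lie_section hp
  have hloc : ∀ (s : ℝ) (u : Loop σ), Loop.mulFun (cutoffSq 𝕜 s) u ∈
      Submodule.span 𝕜 {w : Loop σ | ∃ u v : Loop σ, ⁅u, v⁆ = w} := fun s u => by
    have : Loop.mulFun (cutoffSq 𝕜 s) u = ∑ i,
        ⁅Loop.localize σ s (fun t => a i (u.1 t)) (u.2.1.linearMap_comp (a i)),
          Loop.localConst σ s (Module.finBasis 𝕜 g i)⁆ := by
      refine Loop.ext_window s fun t ht => ?_
      rw [Submodule.coe_sum, Finset.sum_apply, Loop.mulFun_apply, cutoffSq_apply ht]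
      simp only [Loop.lie_apply, Loop.localConst, Loop.localize_apply _ ht, smul_lie, lie_smul]
      rw [← Finset.smul_sum, ← Finset.smul_sum, ← ha, smul_smul]
    rw [this]
    exact Submodule.sum_mem _ fun i _ => Submodule.subset_span ⟨_, _, rfl⟩
  rw [eq_top_iff]
  intro u _
  rw [← Loop.one_mulFun u, ← partition_of_unity, Loop.add_mulFun, Loop.mul_mulFun]
  exact add_mem (hloc _ _) (hloc _ _)

end Perfect

/-! ### Evaluations of loops -/

/-- The function `sin` with values in `𝕜`. -/
def sinFun (𝕜 : Type*) [RCLike 𝕜] : periodicAlgebra 𝕜 :=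
  ⟨fun t => ((Real.sin t : ℝ) : 𝕜), (RCLike.ofRealCLM (K := 𝕜)).contDiff.comp Real.contDiff_sin,
    fun t => by simp only [Real.sin_add_two_pi]⟩

/-- The function `cos` with values in `𝕜`. -/
def cosFun (𝕜 : Type*) [RCLike 𝕜] : periodicAlgebra 𝕜 :=
  ⟨fun t => ((Real.cos t : ℝ) : 𝕜), (RCLike.ofRealCLM (K := 𝕜)).contDiff.comp Real.contDiff_cos,
    fun t => by simp only [Real.cos_add_two_pi]⟩

theorem exists_int_of_cos_eq_of_sin_eq {x y : ℝ} (hc : Real.cos x = Real.cos y)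
    (hs : Real.sin x = Real.sin y) : ∃ n : ℤ, x = y + 2 * Real.pi * n := by
  have h := Real.Angle.cos_sin_inj hc hs
  rw [Real.Angle.angle_eq_iff_two_pi_dvd_sub] at h
  obtain ⟨n, hn⟩ := h
  exact ⟨n, by linarith⟩

/-- Evaluations of loops that differ by automorphisms of `g` are evaluations at points which agree
modulo `2π`. -/
theorem exists_int_of_eval_eq [LieAlgebra.IsSimple 𝕜 g] {s s' : ℝ} {Φ Φ' : g ≃ₗ⁅𝕜⁆ g}
    (h : ∀ u : Loop σ, Φ (u.1 s) = Φ' (u.1 s')) : ∃ n : ℤ, s = s' + 2 * Real.pi * n := by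
  have : Nontrivial g := LieAlgebra.IsSimple.nontrivial 𝕜 g
  obtain ⟨x, hx⟩ := exists_ne (0 : g)
  have hf : ∀ f : periodicAlgebra 𝕜, f.1 s = f.1 s' := fun f => by
    have h1 := h (Loop.mulFun f (Loop.localConst σ s x))
    rw [Loop.mulFun_apply, Loop.mulFun_apply, map_smul, map_smul, ← h,
      Loop.localConst_apply_self] at h1
    exact smul_left_injective 𝕜 (by simpa using hx) h1
  exact exists_int_of_cos_eq_of_sin_eq (RCLike.ofReal_injective (hf (cosFun 𝕜)))
    (RCLike.ofReal_injective (hf (sinFun 𝕜)))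

/-! ### Simple quotients of the loop algebra are evaluations -/

theorem eq_zero_of_forall_lie_eq_zero [LieAlgebra.IsSimple 𝕜 g] {x : g} (h : ∀ y : g, ⁅x, y⁆ = 0) :
    x = 0 := by
  have hx : x ∈ LieAlgebra.center 𝕜 g := by
    rw [LieModule.mem_maxTrivSubmodule]
    intro y
    rw [← lie_skew, h, neg_zero]
  rwa [LieAlgebra.center_eq_bot, LieSubmodule.mem_bot] at hx

theorem derivedSeries_one_eq_top [LieAlgebra.IsSimple 𝕜 g] :
    LieAlgebra.derivedSeries 𝕜 g 1 = ⊤ := by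
  refine (LieAlgebra.IsSimple.eq_bot_or_eq_top _).resolve_left fun h => ?_
  refine LieAlgebra.IsSimple.non_abelian (R := 𝕜) (L := g) ?_
  rw [← lie_abelian_iff_equiv_lie_abelian (LieIdeal.topEquiv (R := 𝕜) (L := g))]
  exact (LieAlgebra.abelian_iff_derived_one_eq_bot (R := 𝕜) (⊤ : LieIdeal 𝕜 g)).2 h

variable [FiniteDimensional 𝕜 g]

/-- Functions that annihilate a nonzero quotient of the loop algebra have a common zero. -/
theorem exists_common_zero {F : Loop σ →ₗ⁅𝕜⁆ g} (hF : F ≠ 0) :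
    ∃ s : ℝ, ∀ f : periodicAlgebra 𝕜, (∀ u, F (Loop.mulFun f u) = 0) → f.1 s = 0 := by
  by_contra! hcon
  choose k hk hks using hcon
  obtain ⟨T, -, hT⟩ :=
    (isCompact_Icc (a := (0 : ℝ) - Real.pi) (b := 0 + Real.pi)).elim_nhds_subcover
    (fun s => {t | (k s).1 t ≠ 0})
    (fun s _ => (k s).2.1.continuous.continuousAt.eventually_ne (hks s))
  have hstar : ∀ f : periodicAlgebra 𝕜, ∃ f' : periodicAlgebra 𝕜,
      ∀ t, f'.1 t = (starRingEnd 𝕜) (f.1 t) := fun f =>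
    ⟨⟨fun t => (starRingEnd 𝕜) (f.1 t), (RCLike.conjCLE (K := 𝕜)).contDiff.comp f.2.1,
      fun t => by simp only [f.2.2]⟩, fun _ => rfl⟩
  choose c hc using hstar
  -- the sum of the `|k s|²` over a finite subcover lies in the annihilator and has no zero
  let G : periodicAlgebra 𝕜 := ∑ s ∈ T, c (k s) * k s
  have hG : ∀ t, G.1 t = ((∑ s ∈ T, ‖(k s).1 t‖ ^ 2 : ℝ) : 𝕜) := fun t => by
    have : G.1 t = ∑ s ∈ T, (c (k s)).1 t * (k s).1 t := by
      simp [G]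
    rw [this]
    push_cast
    refine Finset.sum_congr rfl fun s _ => ?_
    rw [hc, RCLike.conj_mul]
  have hG0 : ∀ t, G.1 t ≠ 0 := fun t => by
    rw [← periodic_int G t (windowIndex 0 t), hG]
    have ht := windowIndex_spec 0 t
    obtain ⟨s, hsT, hs⟩ := Set.mem_iUnion₂.1 (hT ⟨ht.1, ht.2.le⟩)
    norm_cast
    refine (Finset.sum_pos' (fun i _ => by positivity) ⟨s, hsT, ?_⟩).ne'
    have := norm_pos_iff.2 hs
    positivity
  let G' : periodicAlgebra 𝕜 :=
    ⟨fun t => (G.1 t)⁻¹, G.2.1.inv hG0, fun t => by simp only [G.2.2]⟩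
  have hGG' : G * G' = 1 := Subtype.ext <| funext fun t => mul_inv_cancel₀ (hG0 t)
  refine hF (LieHom.ext fun u => ?_)
  have hsum : ∀ (S : Finset ℝ) (v : Loop σ), F (Loop.mulFun (∑ s ∈ S, c (k s) * k s) v) = 0 := by
    intro S v
    induction S using Finset.induction_on with
    | empty =>
      rw [Finset.sum_empty, ← zero_smul 𝕜 (1 : periodicAlgebra 𝕜), Loop.smul_mulFun, zero_smul,
        map_zero]
    | insert a S ha ih =>
      rw [Finset.sum_insert ha, Loop.add_mulFun, map_add, ih, mul_comm, Loop.mul_mulFun, hk,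
        add_zero]
  rw [← Loop.one_mulFun u, ← hGG', Loop.mul_mulFun]
  exact hsum T _

open Polynomial in
/-- If multiplication by `f` descends to `T`, then multiplication by `p(f)` descends to `p(T)`. -/
theorem mulFun_aeval {F : Loop σ →ₗ⁅𝕜⁆ g} {f : periodicAlgebra 𝕜} {T : Module.End 𝕜 g}
    (hT : ∀ u, F (Loop.mulFun f u) = T (F u)) (p : 𝕜[X]) (u : Loop σ) :
    F (Loop.mulFun (aeval f p) u) = aeval T p (F u) := by
  induction p using Polynomial.induction_on' generalizing u with
  | add p q hp hq => rw [map_add, map_add, Loop.add_mulFun, map_add, hp, hq, LinearMap.add_apply]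
  | monomial n a =>
    have h : ∀ (n : ℕ) (u : Loop σ), F (Loop.mulFun (f ^ n) u) = (T ^ n) (F u) := by
      intro n
      induction n with
      | zero => intro u; rw [pow_zero, Loop.one_mulFun, pow_zero, Module.End.one_apply]
      | succ n ih => intro u; rw [pow_succ, Loop.mul_mulFun, ih, hT, pow_succ, Module.End.mul_apply]
    rw [aeval_monomial, aeval_monomial, ← Algebra.smul_def, Loop.smul_mulFun, map_smul, h,
      ← Algebra.smul_def, LinearMap.smul_apply]

section Quotient

variable [LieAlgebra.IsSimple 𝕜 g] {F : Loop σ →ₗ⁅𝕜⁆ g}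

/-- The kernel of a homomorphism onto `g` is stable under multiplication by functions, because the
image of `f u` is central. -/
theorem mulFun_mem_ker (hF : Function.Surjective F) (f : periodicAlgebra 𝕜) {u : Loop σ}
    (hu : F u = 0) : F (Loop.mulFun f u) = 0 := by
  refine eq_zero_of_forall_lie_eq_zero (𝕜 := 𝕜) fun y => ?_
  obtain ⟨v, rfl⟩ := hF y
  rw [← LieHom.map_lie, Loop.mulFun_lie, ← Loop.lie_mulFun, LieHom.map_lie, hu, zero_lie]

/-- Multiplication by a function descends to a simple quotient of the loop algebra. -/
theorem exists_quotient_mul (hF : Function.Surjective F) (f : periodicAlgebra 𝕜) :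
    ∃ T : Module.End 𝕜 g, ∀ u, F (Loop.mulFun f u) = T (F u) := by
  obtain ⟨E, hE⟩ := (F : Loop σ →ₗ[𝕜] g).exists_rightInverse_of_surjective
    (LinearMap.range_eq_top.2 hF)
  have hE' : ∀ x, F (E x) = x := fun x => LinearMap.congr_fun hE x
  let M : Loop σ →ₗ[𝕜] Loop σ :=
    { toFun := Loop.mulFun f, map_add' := Loop.mulFun_add f, map_smul' := Loop.mulFun_smul f }
  refine ⟨(F : Loop σ →ₗ[𝕜] g) ∘ₗ M ∘ₗ E, fun u => ?_⟩
  have h := mulFun_mem_ker hF f (u := u - E (F u)) (by rw [map_sub, hE', sub_self])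
  have h2 : Loop.mulFun f (u - E (F u)) = Loop.mulFun f u - Loop.mulFun f (E (F u)) :=
    map_sub M _ _
  rw [h2, map_sub, sub_eq_zero] at h
  exact h

/-- A function vanishing at a common zero `s` of the annihilator lies in the annihilator. Otherwise
multiplication by it would be invertible on the quotient, and the characteristic polynomial would
produce a function in the annihilator which is not zero at `s`. -/
theorem mulFun_eq_zero_of_apply_eq_zero (hF : Function.Surjective F) {s : ℝ}
    (hs : ∀ f : periodicAlgebra 𝕜, (∀ u, F (Loop.mulFun f u) = 0) → f.1 s = 0)
    {f : periodicAlgebra 𝕜} (hf : f.1 s = 0) (u : Loop σ) : F (Loop.mulFun f u) = 0 := by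
  obtain ⟨T, hT⟩ := exists_quotient_mul hF f
  have hTlie : ∀ x y : g, ⁅x, T y⁆ = T ⁅x, y⁆ := fun x y => by
    obtain ⟨v, rfl⟩ := hF x
    obtain ⟨w, rfl⟩ := hF y
    rw [← hT, ← LieHom.map_lie, Loop.lie_mulFun, hT, LieHom.map_lie]
  let I : LieIdeal 𝕜 g :=
    { LinearMap.range T with
      lie_mem := by
        rintro x _ ⟨y, rfl⟩
        exact ⟨⁅x, y⁆, (hTlie x y).symm⟩ }
  rcases LieAlgebra.IsSimple.eq_bot_or_eq_top (R := 𝕜) I with hI | hI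
  · have : T (F u) ∈ I := ⟨F u, rfl⟩
    rw [hI, LieSubmodule.mem_bot] at this
    rw [hT, this]
  · exfalso
    have hsurj : Function.Surjective T := fun y => by
      have : y ∈ I := hI ▸ LieSubmodule.mem_top y
      exact this
    have hdet : LinearMap.det T ≠ 0 :=
      ((LinearEquiv.ofBijective T ⟨LinearMap.injective_iff_surjective.2 hsurj, hsurj⟩).isUnit_det'
        ).ne_zero
    have h0 := hs (Polynomial.aeval f T.charpoly) fun v => by
      rw [mulFun_aeval hT, LinearMap.aeval_self_charpoly, LinearMap.zero_apply]
    have hev : (Polynomial.aeval f T.charpoly).1 s = Polynomial.aeval (f.1 s) T.charpoly := by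
      have := Polynomial.aeval_algHom_apply
        ((Pi.evalAlgHom 𝕜 (fun _ : ℝ => 𝕜) s).comp (periodicAlgebra 𝕜).val) f T.charpoly
      exact this.symm
    rw [hev, hf, ← Polynomial.coeff_zero_eq_aeval_zero] at h0
    rw [LinearMap.det_eq_sign_charpoly_coeff] at hdet
    simp_all

/-- Every homomorphism of the loop algebra onto the simple algebra `g` is evaluation at a point
followed by an automorphism of `g`. -/
theorem exists_eval_of_surjective (hF : Function.Surjective F) :
    ∃ (s : ℝ) (Φ : g ≃ₗ⁅𝕜⁆ g), ∀ u : Loop σ, F u = Φ (u.1 s) := by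
  have hF0 : F ≠ 0 := by
    rintro rfl
    refine LieAlgebra.IsSimple.non_abelian (R := 𝕜) (L := g) ⟨fun x y => ?_⟩
    obtain ⟨v, rfl⟩ := hF x
    simp
  obtain ⟨s, hs⟩ := exists_common_zero hF0
  have hker : ∀ u : Loop σ, u.1 s = 0 → F u = 0 := fun u hu => by
    have hloc : F (Loop.mulFun (cutoffSq 𝕜 s) u) = 0 := by
      rw [Loop.cutoffSq_mulFun_eq_sum, map_sum]
      refine Finset.sum_eq_zero fun i _ => mulFun_eq_zero_of_apply_eq_zero hF hs ?_ _
      rw [localFun_apply _ (by simp [Real.pi_pos.le]), hu]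
      simp
    have hone : cutoffSq 𝕜 s + (1 - cutoffSq 𝕜 s) = 1 := by ring
    rw [← Loop.one_mulFun u, ← hone, Loop.add_mulFun, map_add, hloc, zero_add]
    refine mulFun_eq_zero_of_apply_eq_zero hF hs ?_ u
    change 1 - (cutoffSq 𝕜 s).1 s = 0
    rw [cutoffSq_apply_self, sub_self]
  have hdep : ∀ u v : Loop σ, u.1 s = v.1 s → F u = F v := fun u v h => by
    rw [← sub_eq_zero, ← map_sub]
    exact hker _ (by change u.1 s - v.1 s = 0; rw [h, sub_self])
  let Φ : g →ₗ⁅𝕜⁆ g :=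
    { toFun := fun x => F (Loop.localConst σ s x)
      map_add' := fun x y => by
        rw [← map_add]
        refine hdep _ _ ?_
        change _ = (Loop.localConst σ s x).1 s + (Loop.localConst σ s y).1 s
        simp only [Loop.localConst_apply_self]
      map_smul' := fun a x => by
        rw [RingHom.id_apply, ← map_smul]
        refine hdep _ _ ?_
        change _ = a • (Loop.localConst σ s x).1 s
        simp only [Loop.localConst_apply_self]
      map_lie' := fun {x y} => by
        rw [← LieHom.map_lie]
        refine hdep _ _ ?_
        simp only [Loop.lie_apply, Loop.localConst_apply_self] }
  have hΦ : ∀ u : Loop σ, F u = Φ (u.1 s) := fun u =>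
    hdep _ _ (Loop.localConst_apply_self s _).symm
  have hsurj : Function.Surjective Φ := fun y => by
    obtain ⟨v, rfl⟩ := hF y
    exact ⟨_, (hΦ v).symm⟩
  have hbij : Function.Bijective Φ :=
    ⟨(LinearMap.injective_iff_surjective (f := (Φ : g →ₗ[𝕜] g))).2 hsurj, hsurj⟩
  exact ⟨s, LieEquiv.ofBijective Φ hbij, hΦ⟩

end Quotient

/-! ### Derivatives of products with periodic functions -/

theorem hasDerivAt_sinFun (t : ℝ) : HasDerivAt (sinFun 𝕜).1 ((cosFun 𝕜).1 t) t :=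
  (RCLike.ofRealCLM (K := 𝕜)).hasDerivAt.scomp t (Real.hasDerivAt_sin t) |>.congr_deriv (by
    simp [cosFun, Algebra.smul_def])

theorem hasDerivAt_cosFun (t : ℝ) : HasDerivAt (cosFun 𝕜).1 (-(sinFun 𝕜).1 t) t :=
  (RCLike.ofRealCLM (K := 𝕜)).hasDerivAt.scomp t (Real.hasDerivAt_cos t) |>.congr_deriv (by
    simp [sinFun, Algebra.smul_def])

theorem Loop.deriv_mulFun {f : periodicAlgebra 𝕜} {t : ℝ} {f' : 𝕜} (hf : HasDerivAt f.1 f' t)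
    (u : Loop σ) : (Loop.mulFun f u).deriv.1 t = f' • u.1 t + f.1 t • u.deriv.1 t := by
  refine dual_ext (𝕜 := 𝕜) fun l => ?_
  have h1 := hasDerivAt_dual (Loop.mulFun f u).2.1 l t
  have h2 := hf.mul (hasDerivAt_dual u.2.1 l t)
  simp only [Loop.mulFun_apply, map_smul, smul_eq_mul] at h1
  rw [map_add, map_smul, map_smul]
  exact h1.unique h2

theorem Loop.dual_deriv (u : Loop σ) (l : Module.Dual 𝕜 g) (t : ℝ) :
    HasDerivAt (fun s => l (u.1 s)) (l (u.deriv.1 t)) t :=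
  hasDerivAt_dual u.2.1 l t

/-- The only multiple of `d` that acts on the loop algebra as an inner derivation is zero. -/
theorem eq_zero_of_lie_add_smul_deriv [LieAlgebra.IsSimple 𝕜 g] {w : Loop σ} {b : 𝕜}
    (h : ∀ v : Loop σ, ⁅w, v⁆ + b • v.deriv = 0) : w = 0 ∧ b = 0 := by
  have h' : ∀ (v : Loop σ) t, ⁅w.1 t, v.1 t⁆ + b • v.deriv.1 t = 0 := fun v t =>
    congrFun (congrArg Subtype.val (h v)) t
  have : Nontrivial g := LieAlgebra.IsSimple.nontrivial 𝕜 g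
  obtain ⟨x, hx⟩ := exists_ne (0 : g)
  have hb : b = 0 := by
    have h1 := h' (Loop.mulFun (sinFun 𝕜) (Loop.localConst σ 0 x)) 0
    rw [Loop.deriv_mulFun (hasDerivAt_sinFun 0), Loop.mulFun_apply,
      Loop.localConst_apply_self] at h1
    simpa [sinFun, cosFun, hx] using h1
  refine ⟨Subtype.ext (funext fun t => eq_zero_of_forall_lie_eq_zero (𝕜 := 𝕜) fun y => ?_), hb⟩
  have h1 := h' (Loop.localConst σ t y) t
  simpa [hb, Loop.localConst_apply_self] using h1

/-! ### The map induced on loop algebras -/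

namespace Affine

theorem eq_ofLoop_add (x : Affine σ) :
    x = ofLoop x.loop + x.coeffC • c σ + x.coeffD • d σ := by
  ext1 <;> simp [ofLoop, c, d]

theorem derived_induction {p : Affine σ → Prop} (hlie : ∀ x y : Affine σ, p ⁅x, y⁆)
    (hzero : p 0) (hadd : ∀ x y, p x → p y → p (x + y)) (hsmul : ∀ (a : 𝕜) x, p x → p (a • x))
    {x : Affine σ} (hx : x ∈ LieAlgebra.derivedSeries 𝕜 (Affine σ) 1) : p x := by
  rw [LieAlgebra.derivedSeries_def, LieAlgebra.derivedSeriesOfIdeal_succ,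
    LieAlgebra.derivedSeriesOfIdeal_zero, ← LieSubmodule.mem_toSubmodule,
    LieSubmodule.lieIdeal_oper_eq_linear_span'] at hx
  induction hx using Submodule.span_induction with
  | mem x h => obtain ⟨y, -, z, -, rfl⟩ := h; exact hlie y z
  | zero => exact hzero
  | add x y _ _ hx hy => exact hadd x y hx hy
  | smul a x _ hx => exact hsmul a x hx

theorem lie_mem_derived (x y : Affine σ) :
    ⁅x, y⁆ ∈ LieAlgebra.derivedSeries 𝕜 (Affine σ) 1 :=
  LieSubmodule.lie_mem_lie (LieSubmodule.mem_top x) (LieSubmodule.mem_top y)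

theorem coeffD_map_eq_zero (φhat : Affine σ ≃ₗ⁅𝕜⁆ Affine τ) {x : Affine σ}
    (hx : x ∈ LieAlgebra.derivedSeries 𝕜 (Affine σ) 1) : (φhat x).coeffD = 0 := by
  refine derived_induction (p := fun x => (φhat x).coeffD = 0) (fun x y => ?_) ?_
    (fun x y hx hy => ?_) (fun a x hx => ?_) hx
  · rw [LieEquiv.map_lie, lie_coeffD]
  · rw [map_zero, zero_coeffD]
  · rw [map_add, add_coeffD, hx, hy, add_zero]
  · rw [map_smul, smul_coeffD, hx, mul_zero]

theorem coeffD_eq_zero {x : Affine σ}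
    (hx : x ∈ LieAlgebra.derivedSeries 𝕜 (Affine σ) 1) : x.coeffD = 0 :=
  coeffD_map_eq_zero LieEquiv.refl hx

variable [LieAlgebra.IsSimple 𝕜 g]

theorem exists_mem_derived (u : Loop σ) :
    ∃ a : 𝕜, (⟨u, a, 0⟩ : Affine σ) ∈ LieAlgebra.derivedSeries 𝕜 (Affine σ) 1 := by
  have hu : u ∈ Submodule.span 𝕜 {w : Loop σ | ∃ u v : Loop σ, ⁅u, v⁆ = w} := by
    rw [Loop.span_lie_eq_top derivedSeries_one_eq_top]
    trivial
  induction hu using Submodule.span_induction with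
  | mem x h =>
    obtain ⟨u, v, rfl⟩ := h
    refine ⟨Loop.form u.deriv v, ?_⟩
    have := lie_mem_derived (ofLoop u) (ofLoop v)
    convert this using 1
    ext1 <;> simp [ofLoop]
  | zero => exact ⟨0, zero_mem _⟩
  | add x y _ _ hx hy =>
    obtain ⟨a, ha⟩ := hx
    obtain ⟨b, hb⟩ := hy
    refine ⟨a + b, ?_⟩
    have := add_mem ha hb
    convert this using 1
    ext1 <;> simp
  | smul a x _ hx =>
    obtain ⟨b, hb⟩ := hx
    refine ⟨a * b, ?_⟩
    have h : a • (⟨x, b, 0⟩ : Affine σ) = ⟨a • x, a * b, 0⟩ := by ext1 <;> simp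
    rw [← h]
    exact (LieAlgebra.derivedSeries 𝕜 (Affine σ) 1).smul_mem a hb

/-- An isomorphism preserves the centre `𝕜 c`. -/
theorem map_c (φhat : Affine σ ≃ₗ⁅𝕜⁆ Affine τ) : φhat (c σ) = (φhat (c σ)).coeffC • c τ := by
  have h : ∀ v : Loop τ, ⁅(φhat (c σ)).loop, v⁆ + (φhat (c σ)).coeffD • v.deriv = 0 := fun v => by
    have h0 : ⁅c σ, φhat.symm (ofLoop v)⁆ = 0 := by
      have hd : (0 : Loop σ).deriv = 0 := by
        simpa using Loop.deriv_smul (0 : 𝕜) (0 : Loop σ)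
      have hf : ∀ w : Loop σ, Loop.form 0 w = 0 := fun w => by
        simpa using Loop.form_smul_left (0 : 𝕜) (0 : Loop σ) w
      ext1 <;> simp [c, hd, hf]
    have h1 := congrArg φhat h0
    rw [LieEquiv.map_lie, LieEquiv.apply_symm_apply, map_zero] at h1
    have h2 := congrArg Affine.loop h1
    simpa [ofLoop] using h2
  obtain ⟨hw, hb⟩ := eq_zero_of_lie_add_smul_deriv h
  conv_lhs => rw [eq_ofLoop_add (φhat (c σ)), hw, hb]
  ext1 <;> simp [ofLoop]

theorem map_c_loop (φhat : Affine σ ≃ₗ⁅𝕜⁆ Affine τ) : (φhat (c σ)).loop = 0 := by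
  rw [map_c]
  simp [c]

theorem map_c_coeffD (φhat : Affine σ ≃ₗ⁅𝕜⁆ Affine τ) : (φhat (c σ)).coeffD = 0 := by
  rw [map_c]
  simp [c]

theorem map_ofLoop_coeffD (φhat : Affine σ ≃ₗ⁅𝕜⁆ Affine τ) (u : Loop σ) :
    (φhat (ofLoop u)).coeffD = 0 := by
  obtain ⟨a, ha⟩ := exists_mem_derived u
  have h := coeffD_map_eq_zero φhat ha
  rw [eq_ofLoop_add (⟨u, a, 0⟩ : Affine σ)] at h
  simpa [map_c_coeffD] using h

theorem map_loop (φhat : Affine σ ≃ₗ⁅𝕜⁆ Affine τ) (x : Affine σ) :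
    (φhat x).loop = (φhat (ofLoop x.loop)).loop + x.coeffD • (φhat (d σ)).loop := by
  conv_lhs => rw [eq_ofLoop_add x]
  simp [map_c_loop]

theorem map_coeffD (φhat : Affine σ ≃ₗ⁅𝕜⁆ Affine τ) (x : Affine σ) :
    (φhat x).coeffD = x.coeffD * (φhat (d σ)).coeffD := by
  conv_lhs => rw [eq_ofLoop_add x]
  simp [map_c_coeffD, map_ofLoop_coeffD]

theorem map_ofLoop_symm_loop (φhat : Affine σ ≃ₗ⁅𝕜⁆ Affine τ) (u : Loop τ) :
    (φhat (ofLoop (φhat.symm (ofLoop u)).loop)).loop = u := by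
  have h := map_loop φhat (φhat.symm (ofLoop u))
  rw [LieEquiv.apply_symm_apply, map_ofLoop_coeffD, zero_smul, add_zero] at h
  exact h.symm

/-- The isomorphism of loop algebras induced by an isomorphism of affine algebras. -/
def inducedEquiv (φhat : Affine σ ≃ₗ⁅𝕜⁆ Affine τ) : Loop σ ≃ₗ⁅𝕜⁆ Loop τ where
  toFun u := (φhat (ofLoop u)).loop
  map_add' u v := by
    rw [← add_loop, ← map_add]
    congr 2
    ext1 <;> simp [ofLoop]
  map_smul' a u := by
    rw [RingHom.id_apply, ← smul_loop, ← map_smul]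
    congr 2
    ext1 <;> simp [ofLoop]
  map_lie' {u v} := by
    have h := map_loop φhat ⁅ofLoop u, ofLoop v⁆
    rw [LieEquiv.map_lie] at h
    simp only [lie_loop, lie_coeffD, map_ofLoop_coeffD, zero_smul, add_zero, sub_zero] at h
    rw [h]
    simp [ofLoop]
  invFun u := (φhat.symm (ofLoop u)).loop
  left_inv u := map_ofLoop_symm_loop φhat.symm u
  right_inv u := map_ofLoop_symm_loop φhat u

theorem induces_iff {φhat : Affine σ ≃ₗ⁅𝕜⁆ Affine τ} {φ : Loop σ ≃ₗ⁅𝕜⁆ Loop τ} :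
    Induces φhat φ ↔ ∀ u, (φhat (ofLoop u)).loop = φ u := by
  constructor
  · intro h u
    obtain ⟨a, ha⟩ := exists_mem_derived u
    have h1 := h _ ha
    rw [map_loop] at h1
    simpa using h1
  · intro h x hx
    rw [map_loop, coeffD_eq_zero hx, h]
    simp

theorem existsUnique_induces (φhat : Affine σ ≃ₗ⁅𝕜⁆ Affine τ) :
    ∃! φ : Loop σ ≃ₗ⁅𝕜⁆ Loop τ, Induces φhat φ :=
  ⟨inducedEquiv φhat, induces_iff.2 fun _ => rfl,
    fun _ h => LieEquiv.ext fun u => (induces_iff.1 h u).symm⟩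

/-- An induced isomorphism intertwines `d/dt` with a multiple of itself, up to an inner
derivation. -/
theorem map_deriv_of_induces {φhat : Affine σ ≃ₗ⁅𝕜⁆ Affine τ} {φ : Loop σ ≃ₗ⁅𝕜⁆ Loop τ}
    (h : Induces φhat φ) (u : Loop σ) :
    φ u.deriv = ⁅(φhat (d σ)).loop, φ u⁆ + (φhat (d σ)).coeffD • (φ u).deriv := by
  rw [induces_iff] at h
  have h1 := map_loop φhat ⁅d σ, ofLoop u⁆
  rw [LieEquiv.map_lie] at h1
  simp only [lie_loop, lie_coeffD, map_ofLoop_coeffD, zero_smul, sub_zero, add_zero, h] at h1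
  rw [h1]
  simp [ofLoop, d]

theorem coeffD_mul_symm (φhat : Affine σ ≃ₗ⁅𝕜⁆ Affine τ) :
    (φhat.symm (d τ)).coeffD * (φhat (d σ)).coeffD = 1 := by
  rw [← map_coeffD, LieEquiv.apply_symm_apply]
  rfl

theorem induces_symm {φhat : Affine σ ≃ₗ⁅𝕜⁆ Affine τ} {φ : Loop σ ≃ₗ⁅𝕜⁆ Loop τ}
    (h : Induces φhat φ) : Induces φhat.symm φ.symm := by
  rw [induces_iff] at h ⊢
  intro u
  apply φ.injective
  change φ _ = φ (φ.symm u)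
  rw [LieEquiv.apply_symm_apply, ← h, map_ofLoop_symm_loop]

end Affine

/-! ### Induced isomorphisms are standard -/

theorem unit_mul_self (𝕜 : Type*) [RCLike 𝕜] (ε : ℤˣ) : ((ε : ℤ) : 𝕜) * ((ε : ℤ) : 𝕜) = 1 := by
  exact_mod_cast Int.units_coe_mul_self ε

section Standard

variable {φ : Loop σ ≃ₗ⁅𝕜⁆ Loop τ} {w : Loop τ} {α : 𝕜} {Φ : ℝ → (g ≃ₗ⁅𝕜⁆ g)} {lam : ℝ → ℝ}

/-- An isomorphism which is pointwise a composition with automorphisms of `g` and an affine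
reparametrization with slope `±1` has equivariant coefficients. -/
theorem aut_period_of_apply_eq {ε : ℤˣ} {t₀ : ℝ}
    (hφ : ∀ (u : Loop σ) (t : ℝ), (φ u).1 t = Φ t (u.1 (((ε : ℤ) : ℝ) * t + t₀))) (t : ℝ) (x : g) :
    Φ (t + 2 * Real.pi) x = τ (Φ t (((σ.toLinearEquiv : g ≃ₗ[𝕜] g) ^ (-(ε : ℤ))) x)) := by
  set y := ((σ.toLinearEquiv : g ≃ₗ[𝕜] g) ^ (-(ε : ℤ))) x
  have h := (φ (Loop.localConst σ (((ε : ℤ) : ℝ) * t + t₀) y)).2.2 t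
  rw [hφ, hφ, Loop.localConst_apply_self, show ((ε : ℤ) : ℝ) * (t + 2 * Real.pi) + t₀
    = (((ε : ℤ) : ℝ) * t + t₀) + 2 * Real.pi * (ε : ℤ) by ring, Loop.apply_add_int,
    Loop.localConst_apply_self] at h
  rw [← h]
  congr 1
  rw [← LinearEquiv.mul_apply, ← zpow_add]
  simp

theorem smoothAutCurve_of_apply_eq {lam : ℝ → ℝ} (hlam : Continuous lam)
    (hφ : ∀ (u : Loop σ) (t : ℝ), (φ u).1 t = Φ t (u.1 (lam t))) : SmoothAutCurve Φ := by
  intro x l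
  rw [contDiff_iff_contDiffAt]
  intro t
  have hcont : ∀ᶠ s in nhds t, |lam s - lam t| < 2 :=
    ContinuousAt.eventually_lt (by fun_prop) continuousAt_const (by simp)
  refine ((φ (Loop.localConst σ (lam t) x)).2.1 l).contDiffAt.congr_of_eventuallyEq ?_
  filter_upwards [hcont] with s hs
  rw [hφ, Loop.localConst_apply x hs.le]

theorem isStandard_of_apply_eq {ε : ℤˣ} {t₀ : ℝ}
    (hφ : ∀ (u : Loop σ) (t : ℝ), (φ u).1 t = Φ t (u.1 (((ε : ℤ) : ℝ) * t + t₀))) :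
    IsStandard φ Φ (fun t => ((ε : ℤ) : ℝ) * t + t₀) ε where
  smooth_aut := smoothAutCurve_of_apply_eq (by fun_prop) hφ
  smooth_lam := by fun_prop
  diffeo := by
    refine ⟨fun t => ((ε : ℤ) : ℝ) * (t - t₀), by fun_prop, fun t => ?_, fun t => ?_⟩
    · linear_combination t * unit_mul_self ℝ ε
    · linear_combination (t - t₀) * unit_mul_self ℝ ε
  lam_period t := by ring
  aut_period := aut_period_of_apply_eq hφ
  apply_eq := hφ

variable [LieAlgebra.IsSimple 𝕜 g]

/-- The reparametrization `lam` scales the derivative of functions by `α⁻¹`. -/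
theorem exists_hasDerivAt_comp (hw : ∀ u, φ u.deriv = ⁅w, φ u⁆ + α • (φ u).deriv)
    (hφ : ∀ (u : Loop σ) (t : ℝ), (φ u).1 t = Φ t (u.1 (lam t))) {f : periodicAlgebra 𝕜} {f' : 𝕜}
    {t : ℝ} (hf : HasDerivAt f.1 f' (lam t)) :
    ∃ D, HasDerivAt (fun s => f.1 (lam s)) D t ∧ f' = α * D := by
  have : Nontrivial g := LieAlgebra.IsSimple.nontrivial 𝕜 g
  obtain ⟨x, hx⟩ := exists_ne (0 : g)
  obtain ⟨l, hl⟩ := Module.Projective.exists_dual_eq_one 𝕜 hx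
  set p := Loop.localConst τ t x
  obtain ⟨u, hu⟩ : ∃ u, φ u = p := ⟨φ.symm p, φ.apply_symm_apply p⟩
  have hmul : ∀ s, (φ (Loop.mulFun f u)).1 s = f.1 (lam s) • p.1 s := fun s => by
    rw [hφ, Loop.mulFun_apply, map_smul, ← hφ, hu]
  have hnear : ∀ᶠ s in nhds t, p.1 s = x := by
    have hcont : ∀ᶠ s in nhds t, |s - t| < 2 :=
      ContinuousAt.eventually_lt (by fun_prop) continuousAt_const (by simp)
    filter_upwards [hcont] with s hs using Loop.localConst_apply x hs.le
  have hpt : p.1 t = x := hnear.self_of_nhds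
  have hp' : l (p.deriv.1 t) = 0 :=
    (Loop.dual_deriv p l t).unique ((hasDerivAt_const t (l x)).congr_of_eventuallyEq
      (hnear.mono fun s hs => by simp only [hs]))
  refine ⟨l ((φ (Loop.mulFun f u)).deriv.1 t), ?_, ?_⟩
  · refine (Loop.dual_deriv (φ (Loop.mulFun f u)) l t).congr_of_eventuallyEq ?_
    filter_upwards [hnear] with s hs
    rw [hmul, hs, map_smul, hl, smul_eq_mul, mul_one]
  · have e1 := congrArg l (congrFun (congrArg Subtype.val (hw (Loop.mulFun f u))) t)
    have e2 := congrArg l (congrFun (congrArg Subtype.val (hw u)) t)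
    change _ = l (⁅w.1 t, _⁆ + α • (φ (Loop.mulFun f u)).deriv.1 t) at e1
    change _ = l (⁅w.1 t, _⁆ + α • (φ u).deriv.1 t) at e2
    rw [hφ, Loop.deriv_mulFun hf, map_add, map_smul, map_smul, ← hφ, ← hφ, hmul, hu, hpt, lie_smul,
      map_add, map_add, map_smul, map_smul, map_smul, hl] at e1
    rw [hu, hpt, map_add, map_smul, hp'] at e2
    rw [e2] at e1
    simp only [map_smul, smul_eq_mul, mul_one, mul_zero, add_zero] at e1
    linear_combination e1

/-- The scaling factor of `exists_hasDerivAt_comp` is real, and modulo `2π` the reparametrization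
is an affine function. -/
theorem exists_affine_mod_period (hw : ∀ u, φ u.deriv = ⁅w, φ u⁆ + α • (φ u).deriv)
    (hφ : ∀ (u : Loop σ) (t : ℝ), (φ u).1 t = Φ t (u.1 (lam t))) :
    ∃ b : ℝ, (b : 𝕜) * α = 1 ∧ ∀ t, ∃ n : ℤ, lam t = b * t + lam 0 + 2 * Real.pi * n := by
  -- a real-valued function has real derivatives
  have hreal : ∀ (h : ℝ → ℝ) (D : 𝕜) (t : ℝ), HasDerivAt (fun s => ((h s : ℝ) : 𝕜)) D t →
      ∃ r : ℝ, HasDerivAt h r t ∧ D = r := fun h D t hD => by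
    have h1 : HasDerivAt h (RCLike.re D) t := by
      simpa [Function.comp_def] using
        (RCLike.reCLM (K := 𝕜)).hasFDerivAt.comp_hasDerivAt t hD
    have h2 : HasDerivAt (fun s => ((h s : ℝ) : 𝕜)) ((RCLike.re D : ℝ) : 𝕜) t := by
      simpa [Function.comp_def] using
        (RCLike.ofRealCLM (K := 𝕜)).hasFDerivAt.comp_hasDerivAt t h1
    exact ⟨_, h1, hD.unique h2⟩
  have hS : ∀ t, ∃ r : ℝ, HasDerivAt (fun s => Real.sin (lam s)) r t ∧
      ((Real.cos (lam t) : ℝ) : 𝕜) = α * r := fun t => by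
    obtain ⟨D, hD, hα⟩ := exists_hasDerivAt_comp hw hφ (hasDerivAt_sinFun (𝕜 := 𝕜) (lam t))
    obtain ⟨r, hr, rfl⟩ := hreal _ _ _ hD
    exact ⟨r, hr, hα⟩
  have hC : ∀ t, ∃ r : ℝ, HasDerivAt (fun s => Real.cos (lam s)) r t ∧
      -((Real.sin (lam t) : ℝ) : 𝕜) = α * r := fun t => by
    obtain ⟨D, hD, hα⟩ := exists_hasDerivAt_comp hw hφ (hasDerivAt_cosFun (𝕜 := 𝕜) (lam t))
    obtain ⟨r, hr, rfl⟩ := hreal _ _ _ hD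
    exact ⟨r, hr, hα⟩
  choose S hS hS' using hS
  choose C hC hC' using hC
  have hsq : ∀ t, ((Real.sin (lam t) : ℝ) : 𝕜) ^ 2 + ((Real.cos (lam t) : ℝ) : 𝕜) ^ 2 = 1 :=
    fun t => by exact_mod_cast Real.sin_sq_add_cos_sq (lam t)
  obtain ⟨b, hb⟩ : ∃ b : ℝ, (b : 𝕜) * α = 1 := by
    refine ⟨Real.cos (lam 0) * S 0 - Real.sin (lam 0) * C 0, ?_⟩
    push_cast at hS' hC' hsq ⊢
    linear_combination hsq 0 - (RCLike.ofReal (Real.cos (lam 0)) : 𝕜) * hS' 0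
      + (RCLike.ofReal (Real.sin (lam 0)) : 𝕜) * hC' 0
  have hS1 : ∀ t, HasDerivAt (fun s => Real.sin (lam s)) (b * Real.cos (lam t)) t := fun t => by
    refine (hS t).congr_deriv (RCLike.ofReal_injective (K := 𝕜) ?_)
    rw [RCLike.ofReal_mul, hS' t]
    linear_combination -(S t : 𝕜) * hb
  have hC1 : ∀ t, HasDerivAt (fun s => Real.cos (lam s)) (b * -Real.sin (lam t)) t := fun t => by
    refine (hC t).congr_deriv (RCLike.ofReal_injective (K := 𝕜) ?_)
    rw [RCLike.ofReal_mul, RCLike.ofReal_neg, hC' t]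
    linear_combination -(C t : 𝕜) * hb
  have hbt : ∀ t, HasDerivAt (fun s : ℝ => b * s) b t := fun t => by
    simpa using (hasDerivAt_id t).const_mul b
  -- `sin (lam t - b t)` and `cos (lam t - b t)` are constant
  have hsin : ∀ t, Real.sin (lam t - b * t) = Real.sin (lam 0) := fun t => by
    have h : ∀ s, HasDerivAt (fun s => Real.sin (lam s - b * s)) 0 s := fun s => by
      simp only [Real.sin_sub]
      refine (((hS1 s).mul (hbt s).cos).sub ((hC1 s).mul (hbt s).sin)).congr_deriv ?_
      ring
    have := is_const_of_deriv_eq_zero (fun s => (h s).differentiableAt) (fun s => (h s).deriv) t 0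
    simpa using this
  have hcos : ∀ t, Real.cos (lam t - b * t) = Real.cos (lam 0) := fun t => by
    have h : ∀ s, HasDerivAt (fun s => Real.cos (lam s - b * s)) 0 s := fun s => by
      simp only [Real.cos_sub]
      refine (((hC1 s).mul (hbt s).cos).add ((hS1 s).mul (hbt s).sin)).congr_deriv ?_
      ring
    have := is_const_of_deriv_eq_zero (fun s => (h s).differentiableAt) (fun s => (h s).deriv) t 0
    simpa using this
  refine ⟨b, hb, fun t => ?_⟩
  obtain ⟨n, hn⟩ := exists_int_of_cos_eq_of_sin_eq (hcos t) (hsin t)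
  exact ⟨n, by linarith⟩

/-- A loop isomorphism that intertwines `d/dt` with `α d/dt + ad w` is pointwise a composition with
an automorphism of `g` and an affine reparametrization whose slope is an integer inverse to `α`. -/
theorem exists_int_slope (hw : ∀ u, φ u.deriv = ⁅w, φ u⁆ + α • (φ u).deriv) :
    ∃ (n : ℤ) (t₀ : ℝ) (Φ : ℝ → (g ≃ₗ⁅𝕜⁆ g)), ((n : ℤ) : 𝕜) * α = 1 ∧
      ∀ (u : Loop σ) (t : ℝ), (φ u).1 t = Φ t (u.1 (n * t + t₀)) := by
  have hev : ∀ t, ∃ (s : ℝ) (Φ : g ≃ₗ⁅𝕜⁆ g), ∀ u : Loop σ, (φ u).1 t = Φ (u.1 s) := fun t => by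
    let F : Loop σ →ₗ⁅𝕜⁆ g :=
      { toFun := fun u => (φ u).1 t
        map_add' := fun u v => by rw [map_add]; rfl
        map_smul' := fun a u => by rw [map_smul]; rfl
        map_lie' := fun {u v} => by rw [LieEquiv.map_lie]; rfl }
    refine exists_eval_of_surjective (F := F) fun x => ⟨φ.symm (Loop.localConst τ t x), ?_⟩
    change (φ _).1 t = x
    rw [LieEquiv.apply_symm_apply, Loop.localConst_apply_self]
  choose lam Φ hφ using hev
  replace hφ : ∀ (u : Loop σ) (t : ℝ), (φ u).1 t = Φ t (u.1 (lam t)) := fun u t => hφ t u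
  obtain ⟨b, hb, hlam⟩ := exists_affine_mod_period hw hφ
  choose m hm using hlam
  let σm : ∀ t : ℝ, g ≃ₗ⁅𝕜⁆ g := fun t =>
    { σ.toLinearEquiv ^ m t with
      map_lie' := fun {x y} => by
        change (σ.toLinearEquiv ^ m t) ⁅x, y⁆ =
          ⁅(σ.toLinearEquiv ^ m t) x, (σ.toLinearEquiv ^ m t) y⁆
        have h := Loop.apply_add_int ⁅Loop.localConst σ 0 x, Loop.localConst σ 0 y⁆ 0 (m t)
        rw [Loop.lie_apply, Loop.lie_apply, Loop.apply_add_int, Loop.apply_add_int] at h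
        simpa only [Loop.localConst_apply_self] using h.symm }
  have hφ' : ∀ (u : Loop σ) (t : ℝ), (φ u).1 t = ((σm t).trans (Φ t)) (u.1 (b * t + lam 0)) :=
    fun u t => by
      rw [hφ, hm, Loop.apply_add_int]
      rfl
  -- the slope is an integer since `φ u` is periodic up to an automorphism
  obtain ⟨n, hn⟩ := exists_int_of_eval_eq (σ := σ)
    (s := b * (0 + 2 * Real.pi) + lam 0) (s' := b * 0 + lam 0)
    (Φ := (σm (0 + 2 * Real.pi)).trans (Φ (0 + 2 * Real.pi)))
    (Φ' := ((σm 0).trans (Φ 0)).trans τ) fun u => by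
      rw [← hφ', (φ u).2.2, LieEquiv.trans_apply, ← hφ']
  have hbn : b = n := by
    have := Real.two_pi_pos.ne'
    apply mul_left_cancel₀ this
    linarith
  subst hbn
  exact ⟨n, lam 0, _, by simpa using hb, hφ'⟩

/-- The slopes belonging to `φ` and to its inverse are integers with product `1`. -/
theorem exists_isStandard_of_induces {φhat : Affine σ ≃ₗ⁅𝕜⁆ Affine τ} (h : Induces φhat φ) :
    ∃ (Φ : ℝ → (g ≃ₗ⁅𝕜⁆ g)) (ε : ℤˣ) (t₀ : ℝ),
      IsStandard φ Φ (fun t => ((ε : ℤ) : ℝ) * t + t₀) ε := by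
  obtain ⟨n, t₀, Φ, hn, hφ⟩ := exists_int_slope (Affine.map_deriv_of_induces h)
  obtain ⟨n', -, -, hn', -⟩ := exists_int_slope
    (Affine.map_deriv_of_induces (Affine.induces_symm h))
  have hnn : n * n' = 1 := by
    have h1 := Affine.coeffD_mul_symm φhat
    have h2 : ((n : ℤ) : 𝕜) * ((n' : ℤ) : 𝕜) = 1 := by
      linear_combination (((n' : ℤ) : 𝕜) * (φhat.symm (Affine.d τ)).coeffD) * hn + hn'
        - (n : 𝕜) * n' * h1
    exact_mod_cast h2
  exact ⟨Φ, Units.mkOfMulEqOne n n' hnn, t₀, isStandard_of_apply_eq hφ⟩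

/-- A loop isomorphism determines its reparametrization up to a multiple of `2π`. -/
theorem IsStandard.lam_affine {Φ' : ℝ → (g ≃ₗ⁅𝕜⁆ g)} {ε ε' : ℤˣ} {t₀ : ℝ}
    (h : IsStandard φ Φ lam ε) (h' : IsStandard φ Φ' (fun t => ((ε' : ℤ) : ℝ) * t + t₀) ε') :
    ∃ t₁ : ℝ, ∀ t, lam t = ((ε : ℤ) : ℝ) * t + t₁ := by
  choose m hm using fun t => exists_int_of_eval_eq (σ := σ) (s := lam t)
    (s' := ((ε' : ℤ) : ℝ) * t + t₀) (Φ := Φ t) (Φ' := Φ' t) fun u => by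
      rw [← h.apply_eq, ← h'.apply_eq]
  have hcont : Continuous fun t => ((m t : ℤ) : ℝ) := by
    have : (fun t => ((m t : ℤ) : ℝ))
        = fun t => (lam t - (((ε' : ℤ) : ℝ) * t + t₀)) / (2 * Real.pi) := funext fun t => by
      rw [hm t, add_sub_cancel_left, mul_div_cancel_left₀ _ Real.two_pi_pos.ne']
    rw [this]
    have := h.smooth_lam.continuous
    fun_prop
  have hm' : Continuous m := Int.isClosedEmbedding_coe_real.isEmbedding.continuous_iff.2 hcont
  have hconst : ∀ t, m t = m 0 := fun t =>
    PreconnectedSpace.constant inferInstance hm'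
  have hlam : ∀ t, lam t = ((ε' : ℤ) : ℝ) * t + t₀ + 2 * Real.pi * m 0 := fun t => by
    rw [hm t, hconst t]
  have hε : ((ε' : ℤ) : ℝ) = ((ε : ℤ) : ℝ) := by
    have h1 := h.lam_period 0
    rw [hlam, hlam] at h1
    apply mul_right_cancel₀ Real.two_pi_pos.ne'
    linarith
  exact ⟨t₀ + 2 * Real.pi * m 0, fun t => by rw [hlam, hε]; ring⟩

end Standard

/-! ### The logarithmic derivative of a curve of automorphisms -/

/-- The product rule for a curve of endomorphisms applied to a curve of vectors. -/
theorem hasDerivAt_apply {A : ℝ → g →ₗ[𝕜] g} (hA : ∀ x, SmoothCurve 𝕜 fun t => A t x) {v : ℝ → g}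
    (hv : SmoothCurve 𝕜 v) (l : Module.Dual 𝕜 g) (t : ℝ) :
    HasDerivAt (fun s => l (A s (v s)))
      (l (curveDeriv 𝕜 (fun s => A s (v t)) t + A t (curveDeriv 𝕜 v t))) t := by
  have hsum : ∀ s x, l (A s x) = ∑ i, (Module.finBasis 𝕜 g).repr x i *
      l (A s (Module.finBasis 𝕜 g i)) := fun s x => dual_apply_eq_sum (l ∘ₗ A s) x
  have h2 : HasDerivAt (fun s => l (A s (v t))) (∑ i, (Module.finBasis 𝕜 g).repr (v t) i *
      l (curveDeriv 𝕜 (fun s => A s (Module.finBasis 𝕜 g i)) t)) t := by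
    simp only [hsum _ (v t)]
    exact HasDerivAt.fun_sum fun i _ => (hasDerivAt_dual (hA _) l t).const_mul _
  rw [map_add, (hasDerivAt_dual (hA (v t)) l t).unique h2, hsum]
  simp only [hsum _ (v _)]
  refine (HasDerivAt.fun_sum fun i _ => (hasDerivAt_dual hv ((Module.finBasis 𝕜 g).coord i) t).mul
    (hasDerivAt_dual (hA (Module.finBasis 𝕜 g i)) l t)).congr_deriv ?_
  rw [← Finset.sum_add_distrib]
  refine Finset.sum_congr rfl fun i _ => ?_
  simp only [Module.Basis.coord_apply]
  ring

theorem smoothCurve_apply {A : ℝ → g →ₗ[𝕜] g} (hA : ∀ x, SmoothCurve 𝕜 fun t => A t x) {v : ℝ → g}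
    (hv : SmoothCurve 𝕜 v) : SmoothCurve 𝕜 fun t => A t (v t) := by
  intro l
  have hsum : ∀ s, l (A s (v s)) = ∑ i, (Module.finBasis 𝕜 g).repr (v s) i *
      l (A s (Module.finBasis 𝕜 g i)) := fun s => dual_apply_eq_sum (l ∘ₗ A s) (v s)
  simp only [hsum]
  exact ContDiff.sum fun i _ => (smoothCurve_iff_repr.1 hv i).mul (hA _ l)

section LogDeriv

variable {Φ : ℝ → (g ≃ₗ⁅𝕜⁆ g)}

theorem curveDeriv_aut_apply (t : ℝ) (x : g) :
    curveDeriv 𝕜 (fun s => Φ s x) t = logDeriv Φ t (Φ t x) := by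
  rw [logDeriv, LieEquiv.symm_apply_apply]

theorem logDeriv_add (hΦ : SmoothAutCurve Φ) (t : ℝ) (x y : g) :
    logDeriv Φ t (x + y) = logDeriv Φ t x + logDeriv Φ t y := by
  have h := curveDeriv_add (hΦ ((Φ t).symm x)) (hΦ ((Φ t).symm y)) t
  simp only [logDeriv]
  rw [← h]
  congr 1
  funext s
  simp

theorem logDeriv_smul (hΦ : SmoothAutCurve Φ) (t : ℝ) (a : 𝕜) (x : g) :
    logDeriv Φ t (a • x) = a • logDeriv Φ t x := by
  have h := curveDeriv_smul a (hΦ ((Φ t).symm x)) t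
  simp only [logDeriv]
  rw [← h]
  congr 1
  funext s
  simp

theorem logDeriv_lie (hΦ : SmoothAutCurve Φ) (t : ℝ) (x y : g) :
    logDeriv Φ t ⁅x, y⁆ = ⁅logDeriv Φ t x, y⁆ + ⁅x, logDeriv Φ t y⁆ := by
  have h := curveDeriv_lie (hΦ ((Φ t).symm x)) (hΦ ((Φ t).symm y)) t
  rw [LieEquiv.apply_symm_apply, LieEquiv.apply_symm_apply] at h
  rw [logDeriv, LieEquiv.map_lie]
  change _ = ⁅curveDeriv 𝕜 _ t, y⁆ + ⁅x, curveDeriv 𝕜 _ t⁆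
  rw [← h]
  congr 1
  funext s
  exact LieEquiv.map_lie _ _ _

theorem hasDerivAt_aut_apply (hΦ : SmoothAutCurve Φ) {v : ℝ → g}
    (hv : SmoothCurve 𝕜 v) (l : Module.Dual 𝕜 g) (t : ℝ) :
    HasDerivAt (fun s => l (Φ s (v s)))
      (l (logDeriv Φ t (Φ t (v t)) + Φ t (curveDeriv 𝕜 v t))) t := by
  rw [← curveDeriv_aut_apply]
  exact hasDerivAt_apply (A := fun t => ((Φ t : g →ₗ⁅𝕜⁆ g) : g →ₗ[𝕜] g)) hΦ hv l t

theorem logDeriv_add_period (hΦ : SmoothAutCurve Φ) {ε : ℤˣ}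
    (hper : ∀ t x, Φ (t + 2 * Real.pi) x =
      τ (Φ t (((σ.toLinearEquiv : g ≃ₗ[𝕜] g) ^ (-(ε : ℤ))) x))) (t : ℝ) (x : g) :
    logDeriv Φ (t + 2 * Real.pi) (τ x) = τ (logDeriv Φ t x) := by
  set y := (Φ (t + 2 * Real.pi)).symm (τ x) with hy
  set z := ((σ.toLinearEquiv : g ≃ₗ[𝕜] g) ^ (-(ε : ℤ))) y with hz
  have hzx : Φ t z = x := by
    have h := hper t y
    rw [hy, LieEquiv.apply_symm_apply, ← hy, ← hz] at h
    exact (τ.injective h).symm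
  refine dual_ext (𝕜 := 𝕜) fun l => ?_
  have h1 : HasDerivAt (fun s => l (Φ (s + 2 * Real.pi) y))
      (l (logDeriv Φ (t + 2 * Real.pi) (τ x))) t :=
    (hasDerivAt_dual (hΦ y) l (t + 2 * Real.pi)).comp_add_const t (2 * Real.pi)
  simp only [hper, ← hz] at h1
  have h2 := hasDerivAt_dual (hΦ z) (l ∘ₗ ((τ : g →ₗ⁅𝕜⁆ g) : g →ₗ[𝕜] g)) t
  rw [curveDeriv_aut_apply, hzx] at h2
  exact h1.unique h2

section Simple

variable [LieAlgebra.IsSimple 𝕜 g]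

/-- Since the Killing form is nondegenerate, it suffices to test smoothness on the functionals it
represents. -/
theorem smoothCurve_of_killingForm {u : ℝ → g}
    (h : ∀ y, ContDiff ℝ ∞ fun t => killingForm 𝕜 g (u t) y) : SmoothCurve 𝕜 u := by
  intro l
  set e := LinearMap.BilinForm.toDual (killingForm 𝕜 g)
    (LieAlgebra.IsKilling.killingForm_nondegenerate 𝕜 g)
  have hl : ∀ x, l x = killingForm 𝕜 g x (e.symm l) := fun x => by
    rw [LieModule.traceForm_comm 𝕜 g g x]
    exact (LinearMap.congr_fun (e.apply_symm_apply l) x).symm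
  simp only [hl]
  exact h _

theorem smoothCurve_aut_symm (hΦ : SmoothAutCurve Φ) (x : g) :
    SmoothCurve 𝕜 fun t => (Φ t).symm x := by
  refine smoothCurve_of_killingForm fun y => ?_
  have h : ∀ t, killingForm 𝕜 g ((Φ t).symm x) y = killingForm 𝕜 g x (Φ t y) := fun t => by
    rw [← LieAlgebra.killingForm_of_equiv_apply (Φ t), LieEquiv.apply_symm_apply]
  simp only [h]
  exact hΦ y (killingForm 𝕜 g x)

theorem smoothCurve_logDeriv (hΦ : SmoothAutCurve Φ) (x : g) :
    SmoothCurve 𝕜 fun t => logDeriv Φ t x := by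
  let A : ℝ → g →ₗ[𝕜] g := fun t =>
    { toFun := fun y => curveDeriv 𝕜 (fun s => Φ s y) t
      map_add' := fun y z => by
        simp only [curveDeriv_aut_apply]
        rw [map_add, logDeriv_add hΦ]
      map_smul' := fun a y => by
        simp only [curveDeriv_aut_apply]
        rw [map_smul, logDeriv_smul hΦ, RingHom.id_apply] }
  exact smoothCurve_apply (A := A) (fun y => (hΦ y).curveDeriv) (smoothCurve_aut_symm hΦ x)

/-- The derivation `-ε φ_t' φ_t⁻¹` is inner, and the element that induces it is a loop. -/
theorem existsUnique_adEquation (hΦ : SmoothAutCurve Φ) {ε : ℤˣ}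
    (hper : ∀ t x, Φ (t + 2 * Real.pi) x =
      τ (Φ t (((σ.toLinearEquiv : g ≃ₗ[𝕜] g) ^ (-(ε : ℤ))) x))) :
    ∃! w : Loop τ, AdEquation Φ ε w := by
  have hinner : ∀ t, ∃ w : g, ∀ x, ⁅w, x⁆ = -(((ε : ℤ) : 𝕜) • logDeriv Φ t x) := fun t => by
    let D : LieDerivation 𝕜 g g :=
      { toFun := logDeriv Φ t
        map_add' := logDeriv_add hΦ t
        map_smul' := logDeriv_smul hΦ t
        leibniz' := fun x y => by
          change logDeriv Φ t ⁅x, y⁆ = ⁅x, logDeriv Φ t y⁆ - ⁅y, logDeriv Φ t x⁆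
          rw [logDeriv_lie hΦ, ← lie_skew y]
          abel }
    obtain ⟨w, hw⟩ := LieDerivation.IsKilling.exists_eq_ad D
    refine ⟨-(((ε : ℤ) : 𝕜) • w), fun x => ?_⟩
    have h : ⁅w, x⁆ = logDeriv Φ t x := by
      have := LieDerivation.congr_fun hw x
      rwa [LieDerivation.ad_apply_apply] at this
    rw [neg_lie, smul_lie, h]
  choose w hw using hinner
  have hsmooth : SmoothCurve 𝕜 w := by
    obtain ⟨a, ha⟩ := exists_lie_section (𝕜 := 𝕜) (g := g) derivedSeries_one_eq_top
    refine smoothCurve_of_killingForm fun y => ?_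
    have h : ∀ t, killingForm 𝕜 g (w t) y = ∑ i,
        -(((ε : ℤ) : 𝕜) * killingForm 𝕜 g (logDeriv Φ t (a i y)) (Module.finBasis 𝕜 g i)) :=
      fun t => by
        conv_lhs => rw [ha y]
        rw [map_sum]
        refine Finset.sum_congr rfl fun i _ => ?_
        rw [← LieModule.traceForm_apply_lie_apply 𝕜 g g, hw, map_neg, map_smul]
        rfl
    simp only [h]
    exact ContDiff.sum fun i _ => (contDiff_const.mul
      (smoothCurve_logDeriv hΦ (a i y) ((killingForm 𝕜 g).flip (Module.finBasis 𝕜 g i)))).neg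
  have hperiod : ∀ t, w (t + 2 * Real.pi) = τ (w t) := fun t => by
    rw [← sub_eq_zero]
    refine eq_zero_of_forall_lie_eq_zero (𝕜 := 𝕜) fun y => ?_
    obtain ⟨x, rfl⟩ := τ.surjective y
    change ⁅_, τ x⁆ = 0
    rw [sub_lie, hw, ← LieEquiv.map_lie, hw, logDeriv_add_period hΦ hper, map_neg, map_smul,
      sub_self]
  refine ⟨⟨w, hsmooth, hperiod⟩, hw, fun v hv => Subtype.ext (funext fun t => ?_)⟩
  rw [← sub_eq_zero]
  refine eq_zero_of_forall_lie_eq_zero (𝕜 := 𝕜) fun y => ?_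
  rw [sub_lie, hv, hw, sub_self]

end Simple

/-! ### Extending a standard isomorphism -/

/-- A standard isomorphism intertwines `d/dt` with `ε d/dt + ad w`. -/
theorem map_deriv_of_adEquation (hΦ : SmoothAutCurve Φ) {φ : Loop σ ≃ₗ⁅𝕜⁆ Loop τ} {ε : ℤˣ} {t₀ : ℝ}
    (hφ : ∀ (u : Loop σ) (t : ℝ), (φ u).1 t = Φ t (u.1 (((ε : ℤ) : ℝ) * t + t₀))) {w : Loop τ}
    (hw : AdEquation Φ ε w) (u : Loop σ) :
    φ u.deriv = ⁅w, φ u⁆ + ((ε : ℤ) : 𝕜) • (φ u).deriv := by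
  refine Subtype.ext (funext fun t => ?_)
  change (φ u.deriv).1 t = ⁅w.1 t, (φ u).1 t⁆ + ((ε : ℤ) : 𝕜) • (φ u).deriv.1 t
  set lam : ℝ → ℝ := fun t => ((ε : ℤ) : ℝ) * t + t₀
  have hlam : HasDerivAt lam ((ε : ℤ) : ℝ) t := by
    exact (((hasDerivAt_id t).const_mul ((ε : ℤ) : ℝ)).add_const t₀).congr_deriv (mul_one _)
  have hv : SmoothCurve 𝕜 fun s => u.1 (lam s) := fun l => (u.2.1 l).comp (by fun_prop)
  have hvd : curveDeriv 𝕜 (fun s => u.1 (lam s)) t = ((ε : ℤ) : 𝕜) • u.deriv.1 (lam t) := by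
    refine dual_ext (𝕜 := 𝕜) fun l => ?_
    refine (hasDerivAt_dual hv l t).unique (((Loop.dual_deriv u l (lam t)).scomp t hlam).congr_deriv
      ?_)
    rw [map_smul, smul_eq_mul, Algebra.smul_def]
    simp
  have hd : (φ u).deriv.1 t = logDeriv Φ t ((φ u).1 t) + ((ε : ℤ) : 𝕜) • (φ u.deriv).1 t := by
    refine dual_ext (𝕜 := 𝕜) fun l => ?_
    have h1 := Loop.dual_deriv (φ u) l t
    simp only [hφ] at h1 ⊢
    rw [h1.unique (hasDerivAt_aut_apply hΦ hv l t), hvd, map_smul]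
  rw [hw, hd, smul_add, smul_smul, unit_mul_self, one_smul]
  abel

end LogDeriv

/-- A standard isomorphism with affine reparametrization is an isometry. -/
theorem form_map_of_apply_eq {Φ : ℝ → (g ≃ₗ⁅𝕜⁆ g)} {φ : Loop σ ≃ₗ⁅𝕜⁆ Loop τ} {ε : ℤˣ} {t₀ : ℝ}
    (hφ : ∀ (u : Loop σ) (t : ℝ), (φ u).1 t = Φ t (u.1 (((ε : ℤ) : ℝ) * t + t₀))) (u v : Loop σ) :
    Loop.form (φ u) (φ v) = Loop.form u v := by
  simp only [Loop.form, hφ, LieAlgebra.killingForm_of_equiv_apply]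
  set k : ℝ → 𝕜 := fun t => killingForm 𝕜 g (u.1 t) (v.1 t)
  have hk : Function.Periodic k (2 * Real.pi) := fun t => by
    simp only [k]
    rw [u.2.2, v.2.2, LieAlgebra.killingForm_of_equiv_apply]
  change (∫ t in (0 : ℝ)..(2 * Real.pi), k (((ε : ℤ) : ℝ) * t + t₀))
    = ∫ t in (0 : ℝ)..(2 * Real.pi), k t
  rcases Int.units_eq_one_or ε with rfl | rfl
  · have h := hk.intervalIntegral_add_eq t₀ 0
    simp only [Units.val_one, Int.cast_one, one_mul]
    rw [intervalIntegral.integral_comp_add_right]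
    simpa [add_comm] using h
  · have h := hk.intervalIntegral_add_eq (t₀ - 2 * Real.pi) 0
    simp only [Units.val_neg, Units.val_one, Int.cast_neg, Int.cast_one, neg_one_mul,
      neg_add_eq_sub]
    rw [intervalIntegral.integral_comp_sub_left]
    simpa using h

/-! ### Isomorphisms of affine algebras extending a loop isomorphism -/

theorem Loop.form_neg_left (u v : Loop σ) : Loop.form (-u) v = -Loop.form u v := by
  rw [← neg_one_smul 𝕜 u, Loop.form_smul_left, neg_one_mul]

section Extension

variable {φ : Loop σ ≃ₗ⁅𝕜⁆ Loop τ} {ε : ℤˣ} {w : Loop τ}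

theorem deriv_map (hw : ∀ u, φ u.deriv = ⁅w, φ u⁆ + ((ε : ℤ) : 𝕜) • (φ u).deriv) (u : Loop σ) :
    (φ u).deriv = ((ε : ℤ) : 𝕜) • (φ u.deriv + -⁅w, φ u⁆) := by
  rw [hw, add_neg_cancel_comm, smul_smul, unit_mul_self, one_smul]

theorem form_deriv_map (hw : ∀ u, φ u.deriv = ⁅w, φ u⁆ + ((ε : ℤ) : 𝕜) • (φ u).deriv)
    (hform : ∀ u v, Loop.form (φ u) (φ v) = Loop.form u v) (u v : Loop σ) :
    Loop.form (φ u).deriv (φ v) =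
      ((ε : ℤ) : 𝕜) * Loop.form u.deriv v - ((ε : ℤ) : 𝕜) * Loop.form (φ ⁅u, v⁆) w := by
  rw [deriv_map hw, Loop.form_smul_left, Loop.form_add_left, Loop.form_neg_left, hform,
    Loop.form_lie, ← LieEquiv.map_lie, Loop.form_comm w]
  ring

theorem form_map_deriv (hw : ∀ u, φ u.deriv = ⁅w, φ u⁆ + ((ε : ℤ) : 𝕜) • (φ u).deriv)
    (u : Loop σ) : Loop.form w.deriv (φ u) = -(((ε : ℤ) : 𝕜) * Loop.form (φ u.deriv) w) := by
  have h := Loop.form_deriv w (φ u)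
  have hz : Loop.form ⁅w, φ u⁆ w = 0 := by
    rw [Loop.form_comm, ← Loop.form_lie, lie_self]
    simpa using Loop.form_smul_left (0 : 𝕜) (0 : Loop τ) (φ u)
  rw [Loop.form_comm w, deriv_map hw, Loop.form_smul_left, Loop.form_add_left, Loop.form_neg_left,
    hz] at h
  linear_combination h

/-- The extension of a standard isomorphism `φ` with `c ↦ ε c`, `d ↦ ε d + w + ν c` and
`u ↦ φ u - ε (φ u, w) c`. -/
def extensionHom (hw : ∀ u, φ u.deriv = ⁅w, φ u⁆ + ((ε : ℤ) : 𝕜) • (φ u).deriv)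
    (hform : ∀ u v, Loop.form (φ u) (φ v) = Loop.form u v) (ν : 𝕜) : Affine σ →ₗ⁅𝕜⁆ Affine τ where
  toFun x := ⟨φ x.loop + x.coeffD • w,
    -(((ε : ℤ) : 𝕜) * Loop.form (φ x.loop) w) + ((ε : ℤ) : 𝕜) * x.coeffC + x.coeffD * ν,
    ((ε : ℤ) : 𝕜) * x.coeffD⟩
  map_add' x y := by
    ext1
    · simp only [Affine.add_loop, Affine.add_coeffD, map_add]
      module
    · simp only [Affine.add_loop, Affine.add_coeffD, Affine.add_coeffC, map_add, Loop.form_add_left]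
      ring
    · simp only [Affine.add_coeffD]
      ring
  map_smul' a x := by
    ext1
    · simp only [Affine.smul_loop, Affine.smul_coeffD, map_smul, RingHom.id_apply]
      module
    · simp only [Affine.smul_loop, Affine.smul_coeffD, Affine.smul_coeffC, map_smul,
        Loop.form_smul_left, RingHom.id_apply]
      ring
    · simp only [Affine.smul_coeffD, RingHom.id_apply]
      ring
  map_lie' {x y} := by
    have hεε := unit_mul_self 𝕜 ε
    have hsub : ∀ u v : Loop σ, φ (u - v) = φ u - φ v := fun u v => map_sub φ u v
    have hneg : ∀ u : Loop σ, -u = (-1 : 𝕜) • u := fun u => by simp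
    ext1
    · simp only [Affine.lie_loop, Affine.lie_coeffD, map_add, hsub, map_smul, LieEquiv.map_lie, hw,
        lie_add, add_lie, lie_smul, smul_lie, lie_self, Loop.deriv_add, Loop.deriv_smul, zero_smul]
      rw [← lie_skew w (φ x.loop)]
      module
    · have e1 := form_deriv_map hw hform x.loop y.loop
      have e2 := form_map_deriv hw x.loop
      have e3 := form_map_deriv hw y.loop
      have e4 := Loop.form_deriv w (φ x.loop)
      have e5 := Affine.form_deriv_self w
      rw [Loop.form_comm w] at e4
      simp only [Affine.lie_loop, Affine.lie_coeffD, Affine.lie_coeffC, sub_eq_add_neg, hneg,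
        map_add, map_smul, Loop.deriv_add, Loop.deriv_smul, Loop.form_add_left,
        Loop.form_add_right, Loop.form_smul_left, Loop.form_smul_right]
      linear_combination -e1 - x.coeffD * e3 + y.coeffD * e2 - y.coeffD * e4
        - x.coeffD * y.coeffD * e5
    · simp only [Affine.lie_coeffD, mul_zero]

/-- `extensionHom` as an isomorphism. -/
def extensionEquiv (hw : ∀ u, φ u.deriv = ⁅w, φ u⁆ + ((ε : ℤ) : 𝕜) • (φ u).deriv)
    (hform : ∀ u v, Loop.form (φ u) (φ v) = Loop.form u v) (ν : 𝕜) : Affine σ ≃ₗ⁅𝕜⁆ Affine τ :=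
  LieEquiv.ofBijective (extensionHom hw hform ν) <| by
    have hεε := unit_mul_self 𝕜 ε
    have hε : ((ε : ℤ) : 𝕜) ≠ 0 := left_ne_zero_of_mul_eq_one hεε
    constructor
    · intro x y h
      have h1 : φ x.loop + x.coeffD • w = φ y.loop + y.coeffD • w := congrArg Affine.loop h
      have h2 : -(((ε : ℤ) : 𝕜) * Loop.form (φ x.loop) w) + ((ε : ℤ) : 𝕜) * x.coeffC + x.coeffD * ν
          = -(((ε : ℤ) : 𝕜) * Loop.form (φ y.loop) w) + ((ε : ℤ) : 𝕜) * y.coeffC + y.coeffD * ν :=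
        congrArg Affine.coeffC h
      have h3 : ((ε : ℤ) : 𝕜) * x.coeffD = ((ε : ℤ) : 𝕜) * y.coeffD := congrArg Affine.coeffD h
      have hD := mul_left_cancel₀ hε h3
      rw [hD] at h1 h2
      have hL := φ.injective (add_right_cancel h1)
      rw [hL] at h2
      exact Affine.ext hL (mul_left_cancel₀ hε (by linear_combination h2)) hD
    · intro y
      set b := ((ε : ℤ) : 𝕜) * y.coeffD
      refine ⟨⟨φ.symm (y.loop - b • w), ((ε : ℤ) : 𝕜) * (y.coeffC
        + ((ε : ℤ) : 𝕜) * Loop.form (y.loop - b • w) w - b * ν), b⟩, ?_⟩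
      change (⟨φ (φ.symm _) + _, -(((ε : ℤ) : 𝕜) * Loop.form (φ (φ.symm _)) w) + _ + _, _⟩ :
        Affine τ) = y
      rw [LieEquiv.apply_symm_apply]
      ext1
      · simp
      · linear_combination (y.coeffC + ((ε : ℤ) : 𝕜) * Loop.form (y.loop - b • w) w - b * ν) * hεε
      · linear_combination y.coeffD * hεε

theorem extensionEquiv_apply (hw : ∀ u, φ u.deriv = ⁅w, φ u⁆ + ((ε : ℤ) : 𝕜) • (φ u).deriv)
    (hform : ∀ u v, Loop.form (φ u) (φ v) = Loop.form u v) (ν : 𝕜) (x : Affine σ) :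
    extensionEquiv hw hform ν x = ⟨φ x.loop + x.coeffD • w,
      -(((ε : ℤ) : 𝕜) * Loop.form (φ x.loop) w) + ((ε : ℤ) : 𝕜) * x.coeffC + x.coeffD * ν,
      ((ε : ℤ) : 𝕜) * x.coeffD⟩ :=
  rfl

variable [LieAlgebra.IsSimple 𝕜 g]

theorem induces_extensionEquiv
    (hw : ∀ u, φ u.deriv = ⁅w, φ u⁆ + ((ε : ℤ) : 𝕜) • (φ u).deriv)
    (hform : ∀ u v, Loop.form (φ u) (φ v) = Loop.form u v) (ν : 𝕜) :
    Induces (extensionEquiv hw hform ν) φ := by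
  rw [Affine.induces_iff]
  intro u
  simp [extensionEquiv_apply, Affine.ofLoop]

theorem exists_killingForm_self_ne_zero : ∃ x : g, killingForm 𝕜 g x x ≠ 0 := by
  by_contra! h
  have : Nontrivial g := LieAlgebra.IsSimple.nontrivial 𝕜 g
  obtain ⟨x, hx⟩ := exists_ne (0 : g)
  refine hx ((LieAlgebra.IsKilling.killingForm_nondegenerate 𝕜 g).1 x fun y => ?_)
  have h1 := h (x + y)
  simp only [map_add, LinearMap.add_apply] at h1
  rw [h, h,
    LieModule.traceForm_comm 𝕜 g g y x] at h1
  simpa using h1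

/-- There are commuting loops `u` and `f u` on which the cocycle `(u', v)` does not vanish. Otherwise
`(u, u)₀` would be constant for every loop `u`. -/
theorem exists_form_deriv_mulFun_ne_zero (σ : g ≃ₗ⁅𝕜⁆ g) :
    ∃ (u : Loop σ) (f : periodicAlgebra 𝕜), Loop.form u.deriv (Loop.mulFun f u) ≠ 0 := by
  by_contra! h
  have hp := Real.two_pi_pos
  -- `f` is chosen as the conjugate of `(u', u)₀`
  have hzero : ∀ (u : Loop σ), ∀ t ∈ Set.Icc (0 : ℝ) (2 * Real.pi),
      killingForm 𝕜 g (u.deriv.1 t) (u.1 t) = 0 := fun u t ht => by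
    have hsm := contDiff_bilin (killingForm 𝕜 g) u.deriv.2.1 u.2.1
    let f : periodicAlgebra 𝕜 :=
      ⟨fun t => (starRingEnd 𝕜) (killingForm 𝕜 g (u.deriv.1 t) (u.1 t)),
        (RCLike.conjCLE (K := 𝕜)).contDiff.comp hsm,
        fun t => by
          simp only [u.2.2, u.deriv.2.2, LieAlgebra.killingForm_of_equiv_apply]⟩
    by_contra hne
    have hcont : Continuous fun t => ‖killingForm 𝕜 g (u.deriv.1 t) (u.1 t)‖ ^ 2 :=
      hsm.continuous.norm.pow 2
    have hpos : 0 < ∫ t in (0 : ℝ)..(2 * Real.pi),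
        ‖killingForm 𝕜 g (u.deriv.1 t) (u.1 t)‖ ^ 2 :=
      intervalIntegral.integral_pos hp hcont.continuousOn
        (fun _ _ => by positivity) ⟨t, ht, by have := norm_pos_iff.2 hne; positivity⟩
    have hint : (fun t => killingForm 𝕜 g (u.deriv.1 t) ((Loop.mulFun f u).1 t))
        = fun t => (RCLike.ofRealCLM (K := 𝕜)) (‖killingForm 𝕜 g (u.deriv.1 t) (u.1 t)‖ ^ 2) :=
      funext fun t => by
        rw [Loop.mulFun_apply, map_smul, smul_eq_mul, RCLike.conj_mul]
        simp
    have h1 := h u f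
    rw [Loop.form, hint, ContinuousLinearMap.intervalIntegral_comp_comm _
      (hcont.intervalIntegrable _ _)] at h1
    exact hpos.ne' (RCLike.ofReal_injective (K := 𝕜) (by simpa using h1))
  obtain ⟨x, hx⟩ := exists_killingForm_self_ne_zero (𝕜 := 𝕜) (g := g)
  -- a loop with `u 0 = 2 x` and `u π = 0`
  set u := Loop.mulFun (1 + cosFun 𝕜) (Loop.localConst σ 0 x) with hu
  have hcont := contDiff_bilin (killingForm 𝕜 g) u.2.1 u.2.1
  have hconst := (convex_Icc (0 : ℝ) (2 * Real.pi)).is_const_of_fderivWithin_eq_zero (𝕜 := ℝ)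
    (f := fun t => killingForm 𝕜 g (u.1 t) (u.1 t))
    (hcont.differentiable (by simp)).differentiableOn
    (fun t ht => by
      have h1 := hasDerivAt_bilin (killingForm 𝕜 g) u.2.1 u.2.1 t
      rw [LieModule.traceForm_comm 𝕜 g g (u.1 t), ← Loop.deriv_apply, hzero u t ht, add_zero] at h1
      have h2 := (h1.hasFDerivAt.hasFDerivWithinAt 
        (s := Set.Icc (0 : ℝ) (2 * Real.pi))).fderivWithin
        (uniqueDiffOn_Icc hp t ht)
      rw [h2]
      ext
      simp)
    (x := 0) (y := Real.pi) ⟨le_rfl, hp.le⟩ ⟨Real.pi_pos.le, by linarith [Real.pi_pos]⟩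
  have h0 : u.1 0 = (2 : 𝕜) • x := by
    rw [hu, Loop.mulFun_apply, Loop.localConst_apply_self]
    congr 1
    change (1 : 𝕜) + ((Real.cos 0 : ℝ) : 𝕜) = 2
    rw [Real.cos_zero, RCLike.ofReal_one]
    norm_num
  have hπ : u.1 Real.pi = 0 := by
    rw [hu, Loop.mulFun_apply]
    change ((1 : 𝕜) + ((Real.cos Real.pi : ℝ) : 𝕜)) • _ = _
    simp
  rw [h0, hπ] at hconst
  simp [hx] at hconst

variable {φhat : Affine σ ≃ₗ⁅𝕜⁆ Affine τ}

theorem map_d_of_induces (hw : ∀ u, φ u.deriv = ⁅w, φ u⁆ + ((ε : ℤ) : 𝕜) • (φ u).deriv)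
    (h : Induces φhat φ) :
    (φhat (Affine.d σ)).loop = w ∧ (φhat (Affine.d σ)).coeffD = ((ε : ℤ) : 𝕜) := by
  have h0 : ∀ v : Loop τ, ⁅(φhat (Affine.d σ)).loop - w, v⁆
      + ((φhat (Affine.d σ)).coeffD - ((ε : ℤ) : 𝕜)) • v.deriv = 0 := fun v => by
    obtain ⟨u, rfl⟩ := φ.surjective v
    change ⁅_, φ u⁆ + _ • (φ u).deriv = 0
    have h1 := Affine.map_deriv_of_induces h u
    rw [hw] at h1
    rw [sub_lie, sub_smul, ← sub_eq_zero.2 h1.symm]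
    abel
  obtain ⟨h1, h2⟩ := eq_zero_of_lie_add_smul_deriv h0
  exact ⟨sub_eq_zero.1 h1, sub_eq_zero.1 h2⟩

/-- The values on `c` and on loops are forced: the difference between the `c`-coefficient of
`φhat u` and `-ε (φ u, w)` is a functional `δ` with `δ [u, v] = (ε - γ) (u', v)`, where
`φhat c = γ c`. Commuting loops show that `γ = ε`, and perfectness that `δ = 0`. -/
theorem coeffC_of_induces (hw : ∀ u, φ u.deriv = ⁅w, φ u⁆ + ((ε : ℤ) : 𝕜) • (φ u).deriv)
    (hform : ∀ u v, Loop.form (φ u) (φ v) = Loop.form u v) (h : Induces φhat φ) :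
    (φhat (Affine.c σ)).coeffC = ((ε : ℤ) : 𝕜) ∧ ∀ u : Loop σ,
      (φhat (Affine.ofLoop u)).coeffC = -(((ε : ℤ) : 𝕜) * Loop.form (φ u) w) := by
  set γ := (φhat (Affine.c σ)).coeffC
  have hi := Affine.induces_iff.1 h
  let δ : Loop σ →ₗ[𝕜] 𝕜 :=
    { toFun := fun u => (φhat (Affine.ofLoop u)).coeffC + ((ε : ℤ) : 𝕜) * Loop.form (φ u) w
      map_add' := fun u v => by
        have : (Affine.ofLoop (u + v) : Affine σ) = Affine.ofLoop u + Affine.ofLoop v := by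
          ext1 <;> simp [Affine.ofLoop]
        rw [this, map_add, map_add, Loop.form_add_left, Affine.add_coeffC]
        ring
      map_smul' := fun a u => by
        have : (Affine.ofLoop (a • u) : Affine σ) = a • Affine.ofLoop u := by
          ext1 <;> simp [Affine.ofLoop]
        rw [this, map_smul, map_smul, Loop.form_smul_left, Affine.smul_coeffC, RingHom.id_apply,
          smul_eq_mul]
        ring }
  have hδ : ∀ u v : Loop σ, δ ⁅u, v⁆ = (((ε : ℤ) : 𝕜) - γ) * Loop.form u.deriv v := fun u v => by
    have h1 : ⁅Affine.ofLoop u, Affine.ofLoop v⁆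
        = Affine.ofLoop ⁅u, v⁆ + Loop.form u.deriv v • Affine.c σ := by
      ext1 <;> simp [Affine.ofLoop, Affine.c]
    have h2 := congrArg (fun x => (φhat x).coeffC) h1
    simp only [LieEquiv.map_lie, map_add, map_smul, Affine.lie_coeffC, Affine.add_coeffC,
      Affine.smul_coeffC, hi] at h2
    change (φhat (Affine.ofLoop ⁅u, v⁆)).coeffC + ((ε : ℤ) : 𝕜) * Loop.form (φ ⁅u, v⁆) w = _
    linear_combination form_deriv_map hw hform u v - h2
  have hγ : γ = ((ε : ℤ) : 𝕜) := by
    obtain ⟨u, f, huf⟩ := exists_form_deriv_mulFun_ne_zero σ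
    have h1 := hδ u (Loop.mulFun f u)
    have h2 : ⁅u, Loop.mulFun f u⁆ = 0 := by
      rw [Loop.lie_mulFun, lie_self]
      exact Subtype.ext (funext fun t => smul_zero (f.1 t))
    rw [h2, map_zero] at h1
    exact (sub_eq_zero.1 ((mul_eq_zero.1 h1.symm).resolve_right huf)).symm
  refine ⟨hγ, fun u => ?_⟩
  have hu : u ∈ Submodule.span 𝕜 {w : Loop σ | ∃ u v : Loop σ, ⁅u, v⁆ = w} := by
    rw [Loop.span_lie_eq_top derivedSeries_one_eq_top]
    trivial
  have hz : δ u = 0 := by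
    have hle : Submodule.span 𝕜 {w : Loop σ | ∃ u v : Loop σ, ⁅u, v⁆ = w} ≤ LinearMap.ker δ := by
      rw [Submodule.span_le]
      rintro _ ⟨u, v, rfl⟩
      change δ _ = 0
      rw [hδ, hγ, sub_self, zero_mul]
    exact hle hu
  exact eq_neg_of_add_eq_zero_left hz

theorem eq_extensionEquiv_of_induces
    (hw : ∀ u, φ u.deriv = ⁅w, φ u⁆ + ((ε : ℤ) : 𝕜) • (φ u).deriv)
    (hform : ∀ u v, Loop.form (φ u) (φ v) = Loop.form u v) (h : Induces φhat φ) :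
    φhat = extensionEquiv hw hform (φhat (Affine.d σ)).coeffC := by
  obtain ⟨hc, hu⟩ := coeffC_of_induces hw hform h
  obtain ⟨hdl, hdd⟩ := map_d_of_induces hw h
  refine LieEquiv.ext fun x => ?_
  rw [extensionEquiv_apply]
  ext1
  · rw [Affine.map_loop, Affine.induces_iff.1 h, hdl]
  · conv_lhs => rw [Affine.eq_ofLoop_add x]
    simp only [map_add, map_smul, Affine.add_coeffC, Affine.smul_coeffC, hc, hu]
    ring
  · rw [Affine.map_coeffD, hdd, mul_comm]

theorem induces_iff_formulas
    (hw : ∀ u, φ u.deriv = ⁅w, φ u⁆ + ((ε : ℤ) : 𝕜) • (φ u).deriv)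
    (hform : ∀ u v, Loop.form (φ u) (φ v) = Loop.form u v) :
    Induces φhat φ ↔ ∃ ν : 𝕜,
      φhat (Affine.c σ) = ((ε : ℤ) : 𝕜) • Affine.c τ ∧
      φhat (Affine.d σ) = ((ε : ℤ) : 𝕜) • Affine.d τ + Affine.ofLoop w + ν • Affine.c τ ∧
      ∀ u : Loop σ, φhat (Affine.ofLoop u) =
        Affine.ofLoop (φ u) + (-(((ε : ℤ) : 𝕜) * Loop.form (φ u) w)) • Affine.c τ := by
  constructor
  · intro h
    have hform0 : Loop.form (0 : Loop τ) w = 0 := by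
      simpa using Loop.form_smul_left (0 : 𝕜) (0 : Loop τ) w
    have h0 : φ 0 = 0 := map_zero φ
    refine ⟨(φhat (Affine.d σ)).coeffC, ?_, ?_, fun u => ?_⟩ <;>
      rw [eq_extensionEquiv_of_induces hw hform h] <;>
      ext1 <;> simp [-neg_smul, extensionEquiv_apply, Affine.c, Affine.d, Affine.ofLoop, hform0, h0]
  · rintro ⟨ν, -, -, h⟩
    rw [Affine.induces_iff]
    intro u
    rw [h]
    simp [-neg_smul, Affine.ofLoop, Affine.c]

theorem existsUnique_induces_coeffC
    (hw : ∀ u, φ u.deriv = ⁅w, φ u⁆ + ((ε : ℤ) : 𝕜) • (φ u).deriv)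
    (hform : ∀ u v, Loop.form (φ u) (φ v) = Loop.form u v) (ν : 𝕜) :
    ∃! φhat : Affine σ ≃ₗ⁅𝕜⁆ Affine τ, Induces φhat φ ∧ (φhat (Affine.d σ)).coeffC = ν := by
  refine ⟨extensionEquiv hw hform ν, ⟨induces_extensionEquiv hw hform ν, ?_⟩, ?_⟩
  · have hform0 : Loop.form (0 : Loop τ) w = 0 := by
      simpa using Loop.form_smul_left (0 : 𝕜) (0 : Loop τ) w
    have h0 : φ 0 = 0 := map_zero φ
    simp [extensionEquiv_apply, Affine.d, hform0, h0]
  · rintro φhat ⟨h, rfl⟩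
    exact eq_extensionEquiv_of_induces hw hform h

end Extension

end KacMoody

end

open KacMoody in
theorem theorem3p3 {𝕜 : Type*} [RCLike 𝕜] {g : Type*} [LieRing g] [LieAlgebra 𝕜 g]
    [FiniteDimensional 𝕜 g] (hg : SimpleCompactIfReal 𝕜 g) (σ τ : g ≃ₗ⁅𝕜⁆ g) :
    -- every isomorphism of the affine algebras induces exactly one loop isomorphism
    (∀ φhat : Affine σ ≃ₗ⁅𝕜⁆ Affine τ, ∃! φ : Loop σ ≃ₗ⁅𝕜⁆ Loop τ, Induces φhat φ) ∧
    -- an induced isomorphism is standard with affine reparametrization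
    (∀ (φhat : Affine σ ≃ₗ⁅𝕜⁆ Affine τ) (φ : Loop σ ≃ₗ⁅𝕜⁆ Loop τ), Induces φhat φ →
      (∃ (Φ : ℝ → (g ≃ₗ⁅𝕜⁆ g)) (ε : ℤˣ) (t₀ : ℝ),
        IsStandard φ Φ (fun t => ((ε : ℤ) : ℝ) * t + t₀) ε) ∧
      (∀ (Φ : ℝ → (g ≃ₗ⁅𝕜⁆ g)) (lam : ℝ → ℝ) (ε : ℤˣ), IsStandard φ Φ lam ε →
        ∃ t₀ : ℝ, ∀ t, lam t = ((ε : ℤ) : ℝ) * t + t₀)) ∧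
    -- conversely, every loop isomorphism of this form extends, in exactly the following ways
    (∀ (φ : Loop σ ≃ₗ⁅𝕜⁆ Loop τ) (Φ : ℝ → (g ≃ₗ⁅𝕜⁆ g)) (ε : ℤˣ) (t₀ : ℝ),
      SmoothAutCurve Φ →
      (∀ (u : Loop σ) (t : ℝ), (φ u).1 t = Φ t (u.1 (((ε : ℤ) : ℝ) * t + t₀))) →
      (∃ φhat : Affine σ ≃ₗ⁅𝕜⁆ Affine τ, Induces φhat φ) ∧
      (∃! w : Loop τ, AdEquation Φ ε w) ∧
      (∀ φhat : Affine σ ≃ₗ⁅𝕜⁆ Affine τ, Induces φhat φ ↔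
        ∃ (w : Loop τ) (ν : 𝕜), AdEquation Φ ε w ∧
          φhat (Affine.c σ) = ((ε : ℤ) : 𝕜) • Affine.c τ ∧
          φhat (Affine.d σ) =
            ((ε : ℤ) : 𝕜) • Affine.d τ + Affine.ofLoop w + ν • Affine.c τ ∧
          ∀ u : Loop σ, φhat (Affine.ofLoop u) =
            Affine.ofLoop (φ u) + (-(((ε : ℤ) : 𝕜) * Loop.form (φ u) w)) • Affine.c τ) ∧
      (∀ ν : 𝕜, ∃! φhat : Affine σ ≃ₗ⁅𝕜⁆ Affine τ,
        Induces φhat φ ∧ (φhat (Affine.d σ)).coeffC = ν)) := by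
  have := hg.1
  refine ⟨Affine.existsUnique_induces, fun φhat φ h => ?_, fun φ Φ ε t₀ hΦ hφ => ?_⟩
  · have hstd := exists_isStandard_of_induces h
    refine ⟨hstd, fun Φ lam ε hlam => ?_⟩
    obtain ⟨Φ', ε', t₀, h'⟩ := hstd
    exact hlam.lam_affine h'
  · have hex := existsUnique_adEquation hΦ (aut_period_of_apply_eq hφ)
    obtain ⟨w, hw, -⟩ := id hex
    have hform := form_map_of_apply_eq hφ
    have hder := map_deriv_of_adEquation hΦ hφ hw
    refine ⟨⟨_, induces_extensionEquiv hder hform 0⟩, hex, fun φhat => ⟨fun h => ?_, ?_⟩,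
      existsUnique_induces_coeffC hder hform⟩
    · obtain ⟨ν, h⟩ := (induces_iff_formulas hder hform).1 h
      exact ⟨w, ν, hw, h⟩
    · rintro ⟨w', ν, hw', h⟩
      exact (induces_iff_formulas (map_deriv_of_adEquation hΦ hφ hw') hform).2 ⟨ν, h⟩
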